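/- For $n\ge 1$, a randomised stopping rule $\tau$ is a family of measurable functions $r_i(v_1,\dots,v_i)\in[0,1]$, $i=1,\dots,n$. On a tuple $\boldsymbol v=(v_1,\dots,v_n)$ it selects offer $i$ with probability $r_i(v_1,\dots,v_i)\prod_{j<i}(1-r_j(v_1,\dots,v_j))$, and $\boldsymbol v_\tau=\sum_{i=1}^n v_i\,r_i(v_1,\dots,v_i)\prod_{j<i}(1-r_j(v_1,\dots,v_j))$ denotes the expected value of the selected offer. Let $\mathcal T$ be the set of all such rules. For a probability distribution $F$ on $[0,\infty)$ with finite mean, let $\mathcal I(F,n)$ be the set of all joint distributions of nonnegative random vectors $\boldsymbol X=(X_1,\dots,X_n)$ with $\max_{1\le i\le n}X_i\sim F$, and put $$V^*(F,n)=\sup_{\tau\in\mathcal T}\ \inf_{\boldsymbol X\in\mathcal I(F,n)}\mathbb E[\boldsymbol X_\tau],\qquad \Pi_F(p)=p\cdot\mathbb P_{X\sim F}(X\ge p),\qquad \Pi^*(F)=\sup_{p\ge 0}\Pi_F(p).$$ **Corollary.** Let $F_{\mathrm{base}}$ be a probability distribution on $[0,\infty)$ with finite mean (its cumulative distribution function is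 also denoted $F_{\mathrm{base}}$) such that $\Pi_{F_{\mathrm{base}}}$ has a unique maximiser $p^*$ on $[0,\infty)$, $F_{\mathrm{base}}$ is three times continuously differentiable at $p^*$ (that is, $C^3$ near $p^*$), and $2F_{\mathrm{base}}'(p^*)+p^*F_{\mathrm{base}}''(p^*)>0$, i.e. $\Pi_{F_{\mathrm{base}}}''(p^*)<0$. Then there are constants $c_1,c_2>0$, depending only on $F_{\mathrm{base}}$, with the following property. Suppose that for every $n\ge1$, $X_{\max}=X_{\max}^{(n)}$ is a nonnegative random variable with finite positive mean and distribution $F_{\max}=F_{\max}^{(n)}$ such that $X_{\max}/\mathbb E[X_{\max}]\sim F_{\mathrm{base}}$. Then for all $n\ge 1$ $$\Pi^*(F_{\max})+c_1\frac{\mathbb E[X_{\max}]}{n^2}\ \le\ V^*(F_{\max},n)\ \le\ \Pi^*(F_{\max})+c_2\frac{\mathbb E[X_{\max}]}{n^2},$$ that is, $V^*(F_{\max},n)=\Pi^*(F_{\max})+\Theta\!\left(\mathbb E[X_{\max}]/n^2\right)$. -/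

import Mathlib

open MeasureTheory ProbabilityTheory

/-- A randomised stopping rule for `n` sequentially revealed values: having seen `v 0, …, v i`
and not having stopped before, the rule accepts `v i` with probability `r i v`, which depends on
`v 0, …, v i` only. -/
structure StoppingRule (n : ℕ) where
  r : Fin n → (Fin n → ℝ) → ℝ
  nonneg : ∀ i v, 0 ≤ r i v
  le_one : ∀ i v, r i v ≤ 1
  measurable : ∀ i, Measurable (r i)
  adapted : ∀ i (v w : Fin n → ℝ), (∀ j, j ≤ i → v j = w j) → r i v = r i w

/-- The probability that the rule selects the `i`-th offer of the tuple `v`. -/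
noncomputable def StoppingRule.stopProb {n : ℕ} (τ : StoppingRule n) (i : Fin n)
    (v : Fin n → ℝ) : ℝ :=
  τ.r i v * ∏ j ∈ Finset.Iio i, (1 - τ.r j v)

/-- The expected value of the offer that the rule selects on the fixed tuple `v`
(nothing is earned if no offer is selected). -/
noncomputable def StoppingRule.payoff {n : ℕ} (τ : StoppingRule n) (v : Fin n → ℝ) : ℝ :=
  ∑ i, v i * τ.stopProb i v

/-- `F` is the law of a nonnegative random variable with finite expectation. -/
structure IsValueLaw (F : Measure ℝ) : Prop where
  isProbabilityMeasure : IsProbabilityMeasure F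
  nonneg : ∀ᵐ x ∂F, 0 ≤ x
  integrable : Integrable (fun x : ℝ => x) F

/-- The expectation of a random variable with law `F`. -/
noncomputable def lawMean (F : Measure ℝ) : ℝ := ∫ x, x ∂F

/-- The joint laws of nonnegative random vectors `(X_1, …, X_n)` whose maximum has law `F`. -/
def instanceSet (F : Measure ℝ) (n : ℕ) : Set (Measure (Fin n → ℝ)) :=
  {μ | IsProbabilityMeasure μ ∧ (∀ᵐ v ∂μ, ∀ i, 0 ≤ v i) ∧
    μ.map (fun v : Fin n → ℝ => ⨆ i, v i) = F}

/-- `V*(F, n)`: the supremum over randomised stopping rules of the infimum over instances of the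
expected payoff. For `1 ≤ n` and a law `F` as in `IsValueLaw`, all payoffs that occur lie between
`0` and the mean of `F`, and there are instances, so that the supremum and the infima are genuine
ones. -/
noncomputable def robustValue (F : Measure ℝ) (n : ℕ) : ℝ :=
  ⨆ τ : StoppingRule n, ⨅ μ : instanceSet F n, ∫ v, τ.payoff v ∂(μ : Measure (Fin n → ℝ))

/-- The revenue function `Π(p) = p · P(X ≥ p)` of a law `F`. -/
noncomputable def revenue (F : Measure ℝ) (p : ℝ) : ℝ := p * F.real (Set.Ici p)

/-- `Π*(F)`: the largest revenue `Π(p)` over prices `p ≥ 0`. -/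
noncomputable def optRevenue (F : Measure ℝ) : ℝ := ⨆ p : Set.Ici (0 : ℝ), revenue F p

/-- `p` is the unique monopoly price of `F`: the only maximiser of the revenue over `[0, ∞)`. -/
def IsUniqueMonopolyPrice (F : Measure ℝ) (p : ℝ) : Prop :=
  0 ≤ p ∧ ∀ q, 0 ≤ q → q ≠ p → revenue F q < revenue F p

/-! By homogeneity everything reduces to the base law. Write S(q) for the mass of [q, ∞), Π(q) = q
S(q), and p for the maximiser. Smoothness and the second-order condition squeeze Π(p) - Π(q) between
two multiples of (q - p)² near p.

Upper bound (`robustValue_le_of_classes`). Cut the values into n increasing classes, offer the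
maximum Y at the index of its class, precede it by independent decoys from the earlier classes and
follow it by zeros. Seeing y at index k, the gambler cannot tell a decoy from Y; the decoy law is
tuned so that stopping at k earns at most V times the probability of stopping at k on a pure decoy
sequence. These probabilities sum to at most 1, so no rule beats V. A class [a, b) admits such a
decoy law once b S(a) ≤ V, hence once b - a ≤ V - Π(a). So n must exceed the number of such steps
needed to climb past p (`PriceChain`). With V = Π(p) + e, the steps near p have length of order (q -
p)² + e, and about 1/√e of them suffice; thus e of order 1/n² is enough.

Lower bound (`le_robustValue`). Draw a threshold uniformly from [p, p + w] and take the first value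
reaching it. Averaging Π over the thresholds loses O(w²). But offers arrive in only n jumps, so the
accepted value overshoots the threshold, which gains of order w/n by Cauchy-Schwarz. Taking w a
small multiple of 1/n leaves a net gain of order 1/n². -/

/-! ### The law of a single decoy -/

/-- The decoy has density h = y / (V - y s) against F on A, the solution of s y h + y = V h; the
missing mass sits at 0. Here s is the chance that the maximum lies in a later class, and g will be
the stopping probability as a function of the current offer. -/
lemma exists_decoyLaw {F : Measure ℝ} [IsProbabilityMeasure F] (hF : ∀ᵐ y ∂F, 0 ≤ y)
    {A : Set ℝ} (hA : MeasurableSet A) {s V : ℝ} (hs : 0 ≤ s)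
    (hlt : ∀ᵐ y ∂F, y ∈ A → y * s < V)
    (hmass : ∫⁻ y in A, ENNReal.ofReal (y / (V - y * s)) ∂F ≤ 1) :
    ∃ ν : Measure ℝ, IsProbabilityMeasure ν ∧ (∀ᵐ y ∂ν, y = 0 ∨ (0 ≤ y ∧ y ∈ A)) ∧
      ∀ g : ℝ → ENNReal, Measurable g →
        ENNReal.ofReal s * ∫⁻ y, ENNReal.ofReal y * g y ∂ν +
          ∫⁻ y in A, ENNReal.ofReal y * g y ∂F ≤ ENNReal.ofReal V * ∫⁻ y, g y ∂ν := by
  set h : ℝ → ENNReal := fun y => ENNReal.ofReal (y / (V - y * s)) with hh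
  have hhm : Measurable h := by fun_prop
  refine ⟨(F.restrict A).withDensity h + (1 - ∫⁻ y in A, h y ∂F) • Measure.dirac 0, ⟨?_⟩, ?_, ?_⟩
  · simp only [Measure.coe_add, Pi.add_apply, Measure.smul_apply, measure_univ, smul_eq_mul,
      mul_one, withDensity_apply _ MeasurableSet.univ, Measure.restrict_univ]
    exact add_tsub_cancel_of_le hmass
  · rw [ae_add_measure_iff]
    constructor
    · refine (withDensity_absolutelyContinuous _ _).ae_le ?_
      filter_upwards [ae_restrict_mem hA, ae_restrict_of_ae hF] with y hy hy0
      exact Or.inr ⟨hy0, hy⟩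
    · refine Measure.ae_smul_measure ?_ _
      rw [ae_dirac_eq]
      exact Or.inl rfl
  · intro g hg
    have hyg : Measurable fun y => ENNReal.ofReal y * g y := by fun_prop
    simp only [lintegral_add_measure, lintegral_smul_measure, lintegral_dirac,
      ENNReal.ofReal_zero, zero_mul, smul_zero, add_zero, mul_add]
    -- The atom at 0 earns nothing, so it only enlarges the right-hand side.
    refine le_trans ?_ le_self_add
    rw [lintegral_withDensity_eq_lintegral_mul _ hhm hyg,
      lintegral_withDensity_eq_lintegral_mul _ hhm hg,
      ← lintegral_const_mul _ (hhm.mul hyg), ← lintegral_const_mul _ (hhm.mul hg),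
      ← lintegral_add_right _ hyg]
    refine lintegral_mono_ae ?_
    filter_upwards [ae_restrict_mem hA, ae_restrict_of_ae hF, ae_restrict_of_ae hlt]
      with y hy hy0 hyV
    have hpos : 0 < V - y * s := sub_pos.2 (hyV hy)
    have hV0 : 0 ≤ V := by nlinarith [mul_nonneg hy0 hs]
    have hq : 0 ≤ y / (V - y * s) := div_nonneg hy0 hpos.le
    have key : ENNReal.ofReal s * h y * ENNReal.ofReal y + ENNReal.ofReal y
        = ENNReal.ofReal V * h y := by
      rw [hh, ← ENNReal.ofReal_mul hs, ← ENNReal.ofReal_mul (mul_nonneg hs hq),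
        ← ENNReal.ofReal_add (mul_nonneg (mul_nonneg hs hq) hy0) hy0, ← ENNReal.ofReal_mul hV0]
      congr 1
      linear_combination -div_mul_cancel₀ y hpos.ne'
    simp only [Pi.mul_apply]
    rw [← mul_assoc, ← mul_assoc, ← mul_assoc, ← key, add_mul]

/-! ### Elementary properties of stopping rules -/

namespace StoppingRule

variable {n : ℕ} (τ : StoppingRule n)

instance : Nonempty (StoppingRule n) :=
  ⟨⟨fun _ _ => 0, fun _ _ => le_rfl, fun _ _ => zero_le_one, fun _ => measurable_const,
    fun _ _ _ _ => rfl⟩⟩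

lemma stopProb_nonneg (i : Fin n) (v : Fin n → ℝ) : 0 ≤ τ.stopProb i v :=
  mul_nonneg (τ.nonneg i v) (Finset.prod_nonneg fun j _ => sub_nonneg.2 (τ.le_one j v))

lemma sum_stopProb_le_one (v : Fin n → ℝ) : ∑ i, τ.stopProb i v ≤ 1 := by
  have h := Finset.prod_one_sub_ordered Finset.univ fun i => τ.r i v
  have h0 : 0 ≤ ∏ i, (1 - τ.r i v) :=
    Finset.prod_nonneg fun j _ => sub_nonneg.2 (τ.le_one j v)
  have h1 : ∑ i, τ.r i v * ∏ j ∈ Finset.univ with j < i, (1 - τ.r j v)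
      = ∑ i, τ.stopProb i v := by
    refine Finset.sum_congr rfl fun i _ => ?_
    rw [stopProb]
    congr 2
    ext j
    simp
  rw [h1] at h
  linarith

lemma measurable_stopProb (i : Fin n) : Measurable (τ.stopProb i) := by
  unfold stopProb
  exact (τ.measurable i).mul
    (Finset.measurable_fun_prod _ fun j _ => measurable_const.sub (τ.measurable j))

lemma stopProb_congr (i : Fin n) {v w : Fin n → ℝ} (h : ∀ j, j ≤ i → v j = w j) :
    τ.stopProb i v = τ.stopProb i w := by
  unfold stopProb
  rw [τ.adapted i v w h]
  congr 1
  refine Finset.prod_congr rfl fun j hj => ?_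
  rw [τ.adapted j v w fun l hl => h l (hl.trans (Finset.mem_Iio.1 hj).le)]

lemma measurable_payoff : Measurable τ.payoff := by
  unfold payoff
  exact Finset.measurable_fun_sum _ fun i _ => (measurable_pi_apply i).mul (τ.measurable_stopProb i)

lemma payoff_nonneg {v : Fin n → ℝ} (hv : ∀ i, 0 ≤ v i) : 0 ≤ τ.payoff v :=
  Finset.sum_nonneg fun i _ => mul_nonneg (hv i) (τ.stopProb_nonneg i v)

lemma payoff_le {v : Fin n → ℝ} (hv : ∀ i, 0 ≤ v i) : τ.payoff v ≤ ⨆ i, v i := by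
  have hb : BddAbove (Set.range v) := Set.finite_range v |>.bddAbove
  have h0 : 0 ≤ ⨆ i, v i := Real.iSup_nonneg hv
  calc τ.payoff v ≤ ∑ i, (⨆ i, v i) * τ.stopProb i v :=
        Finset.sum_le_sum fun i _ =>
          mul_le_mul_of_nonneg_right (le_ciSup hb i) (τ.stopProb_nonneg i v)
    _ = (⨆ i, v i) * ∑ i, τ.stopProb i v := by rw [Finset.mul_sum]
    _ ≤ ⨆ i, v i := mul_le_of_le_one_right h0 (τ.sum_stopProb_le_one v)

end StoppingRule

lemma bddBelow_range_integral_payoff {F : Measure ℝ} {n : ℕ} (τ : StoppingRule n) :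
    BddBelow (Set.range fun μ : instanceSet F n =>
      ∫ v, τ.payoff v ∂(μ : Measure (Fin n → ℝ))) := by
  refine ⟨0, ?_⟩
  rintro _ ⟨μ, rfl⟩
  refine integral_nonneg_of_ae ?_
  filter_upwards [μ.2.2.1] with v hv
  exact τ.payoff_nonneg hv

/-! ### The adversarial instance built from decoys -/

/-- The tuple in which the maximum `z.1` is offered at its class, preceded by the decoys `z.2`
and followed by zeros. -/
noncomputable def decoyTuple (K : ℝ → ℕ) {n : ℕ} (z : ℝ × (Fin n → ℝ)) : Fin n → ℝ :=
  fun k => if (k : ℕ) < K z.1 then z.2 k else if K z.1 = k then z.1 else 0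

lemma measurable_decoyTuple {K : ℝ → ℕ} (hK : Measurable K) {n : ℕ} :
    Measurable (decoyTuple K (n := n)) := by
  refine measurable_pi_lambda _ fun k => ?_
  refine Measurable.ite ?_ (by fun_prop) (Measurable.ite ?_ (by fun_prop) measurable_const)
  · exact (hK.comp measurable_fst) (measurableSet_Ioi (a := (k : ℕ)))
  · exact (hK.comp measurable_fst) (measurableSet_singleton (k : ℕ))

/-- Each decoy shown is 0 or belongs to a class strictly below that of `z.1`, so by monotonicity of
`K` it cannot exceed `z.1`. -/
lemma iSup_decoyTuple {K : ℝ → ℕ} (hK : Monotone K) {n : ℕ} (hKn : ∀ y, K y < n)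
    {z : ℝ × (Fin n → ℝ)} (h0 : 0 ≤ z.1) (hd : ∀ k : Fin n, z.2 k = 0 ∨ (0 ≤ z.2 k ∧ K (z.2 k) = k)) :
    ⨆ k, decoyTuple K z k = z.1 := by
  have : Nonempty (Fin n) := ⟨⟨K z.1, hKn _⟩⟩
  apply le_antisymm
  · refine ciSup_le fun k => ?_
    unfold decoyTuple
    split_ifs with h1 h2
    · rcases hd k with h | ⟨_, h⟩
      · rw [h]; exact h0
      · by_contra! hlt
        have := hK hlt.le
        omega
    · exact le_rfl
    · exact h0
  · refine le_ciSup_of_le (Set.finite_range (decoyTuple K z)).bddAbove ⟨K z.1, hKn _⟩ ?_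
    simp [decoyTuple]

lemma decoyTuple_nonneg {K : ℝ → ℕ} {n : ℕ}
    {z : ℝ × (Fin n → ℝ)} (h0 : 0 ≤ z.1) (hd : ∀ k : Fin n, z.2 k = 0 ∨ (0 ≤ z.2 k ∧ K (z.2 k) = k))
    (k : Fin n) : 0 ≤ decoyTuple K z k := by
  unfold decoyTuple
  split_ifs with h1 h2
  · rcases hd k with h | ⟨h, _⟩
    · rw [h]
    · exact h
  · exact h0
  · exact le_rfl

/-- Up to the class of the maximum the history consists of decoys alone, so adaptedness lets the
stopping probability be evaluated on the decoy vector, with entry k replaced by y if y itself is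
offered there. -/
lemma ofReal_decoyTuple_mul_stopProb (K : ℝ → ℕ) {n : ℕ} (τ : StoppingRule n) (k : Fin n) (y : ℝ)
    (d : Fin n → ℝ) :
    ENNReal.ofReal (decoyTuple K (y, d) k * τ.stopProb k (decoyTuple K (y, d))) =
      {y | (k : ℕ) < K y}.indicator
        (fun _ => ENNReal.ofReal (d k) * ENNReal.ofReal (τ.stopProb k d)) y +
      {y | K y = k}.indicator
        (fun y => ENNReal.ofReal y * ENNReal.ofReal (τ.stopProb k (Function.update d k y))) y := by
  rw [ENNReal.ofReal_mul' (τ.stopProb_nonneg _ _)]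
  rcases lt_trichotomy (k : ℕ) (K y) with h | h | h
  · have h1 : τ.stopProb k (decoyTuple K (y, d)) = τ.stopProb k d := by
      refine τ.stopProb_congr k fun j hj => ?_
      have : (j : ℕ) < K y := lt_of_le_of_lt hj h
      simp [decoyTuple, this]
    simp [h1, decoyTuple, h, h.ne']
  · have h1 : τ.stopProb k (decoyTuple K (y, d)) = τ.stopProb k (Function.update d k y) := by
      refine τ.stopProb_congr k fun j hj => ?_
      rcases hj.lt_or_eq with hj | rfl
      · have : (j : ℕ) < K y := h ▸ hj
        simp [decoyTuple, this, hj.ne]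
      · simp [decoyTuple, ← h]
    simp [h1, decoyTuple, ← h]
  · simp [decoyTuple, h.not_gt, h.ne]

lemma lintegral_decoyTuple_term_le {F : Measure ℝ} [IsProbabilityMeasure F] {K : ℝ → ℕ}
    (hK : Measurable K) {n : ℕ} (τ : StoppingRule n) (k : Fin n) (V : ℝ)
    (ν : Fin n → Measure ℝ) [∀ i, IsProbabilityMeasure (ν i)]
    (hν : ∀ g : ℝ → ENNReal, Measurable g →
        ENNReal.ofReal (F.real {y | (k : ℕ) < K y}) * ∫⁻ y, ENNReal.ofReal y * g y ∂(ν k) +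
          ∫⁻ y in {y | K y = k}, ENNReal.ofReal y * g y ∂F
            ≤ ENNReal.ofReal V * ∫⁻ y, g y ∂(ν k)) :
    ∫⁻ z, ENNReal.ofReal (decoyTuple K z k * τ.stopProb k (decoyTuple K z))
        ∂(F.prod (Measure.pi ν)) ≤
      ENNReal.ofReal V * ∫⁻ d, ENNReal.ofReal (τ.stopProb k d) ∂(Measure.pi ν) := by
  have hX := measurable_decoyTuple hK (n := n)
  have hσ := τ.measurable_stopProb k
  have hS : MeasurableSet {y | (k : ℕ) < K y} := hK (measurableSet_Ioi (a := (k : ℕ)))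
  have hA : MeasurableSet {y | K y = k} := hK (measurableSet_singleton (k : ℕ))
  have hupd : Measurable fun p : (Fin n → ℝ) × ℝ => Function.update p.1 k p.2 := by
    refine measurable_pi_lambda _ fun j => ?_
    by_cases h : j = k
    · subst h; simpa using measurable_snd
    · simp only [Function.update_of_ne h]
      fun_prop
  have hB : Measurable fun p : (Fin n → ℝ) × ℝ =>
      ENNReal.ofReal p.2 * ENNReal.ofReal (τ.stopProb k (Function.update p.1 k p.2)) :=
    (ENNReal.measurable_ofReal.comp measurable_snd).mul
      (ENNReal.measurable_ofReal.comp (hσ.comp hupd))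
  have hBy (d : Fin n → ℝ) : Measurable fun y : ℝ =>
      ENNReal.ofReal y * ENNReal.ofReal (τ.stopProb k (Function.update d k y)) :=
    hB.comp measurable_prodMk_left
  have hinner (d : Fin n → ℝ) :
      ∫⁻ y, ENNReal.ofReal (decoyTuple K (y, d) k * τ.stopProb k (decoyTuple K (y, d))) ∂F =
      ENNReal.ofReal (F.real {y | (k : ℕ) < K y}) *
        (ENNReal.ofReal (d k) * ENNReal.ofReal (τ.stopProb k d)) +
      ∫⁻ y in {y | K y = k},
        ENNReal.ofReal y * ENNReal.ofReal (τ.stopProb k (Function.update d k y)) ∂F := by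
    simp_rw [ofReal_decoyTuple_mul_stopProb]
    rw [lintegral_add_left (measurable_const.indicator hS), lintegral_indicator_const hS,
      lintegral_indicator hA, mul_comm, ofReal_measureReal]
  rw [lintegral_prod_symm _ (by fun_prop)]
  simp_rw [hinner]
  rw [← lintegral_const_mul _ (by fun_prop)]
  have hI : Measurable fun d : Fin n → ℝ => ∫⁻ y in {y | K y = k},
      ENNReal.ofReal y * ENNReal.ofReal (τ.stopProb k (Function.update d k y)) ∂F :=
    hB.lintegral_prod_right'
  -- Freezing all decoys except the k-th turns the claim into `hν` for the resulting function of one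
  -- variable; the term in which the maximum is offered does not depend on that decoy.
  refine lintegral_le_of_lmarginal_le {k} ?_ (by fun_prop) ?_
  · exact Measurable.add (by fun_prop) hI
  · rw [lmarginal_singleton, lmarginal_singleton]
    intro d
    have hg : Measurable fun x : ℝ => ENNReal.ofReal (τ.stopProb k (Function.update d k x)) :=
      ENNReal.measurable_ofReal.comp (hσ.comp (hupd.comp measurable_prodMk_left))
    have := hν _ hg
    simp only [Function.update_self, Function.update_idem]
    rw [lintegral_add_right _ measurable_const, lintegral_const, measure_univ, mul_one,
      lintegral_const_mul _ (by fun_prop), lintegral_const_mul _ hg]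
    exact this

theorem robustValue_le_of_classes {F : Measure ℝ} (hF : IsValueLaw F) {n : ℕ} {V : ℝ} (hV : 0 ≤ V)
    {K : ℝ → ℕ} (hK : Monotone K) (hKn : ∀ y, K y < n)
    (hlt : ∀ k < n, ∀ᵐ y ∂F, K y = k → y * F.real {z | k < K z} < V)
    (hmass : ∀ k < n,
      ∫⁻ y in {y | K y = k}, ENNReal.ofReal (y / (V - y * F.real {z | k < K z})) ∂F ≤ 1) :
    robustValue F n ≤ V := by
  have := hF.isProbabilityMeasure
  have hKm : Measurable K := hK.measurable
  have hA (k : ℕ) : MeasurableSet {y | K y = k} := hKm (measurableSet_singleton k)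
  choose ν hν1 hν2 hν3 using fun k : Fin n =>
    exists_decoyLaw hF.nonneg (hA k) measureReal_nonneg (hlt k k.2) (hmass k k.2)
  set P := F.prod (Measure.pi ν) with hP
  have hX := measurable_decoyTuple hKm (n := n)
  have h0 : ∀ᵐ z ∂P, 0 ≤ z.1 := Measure.quasiMeasurePreserving_fst.ae hF.nonneg
  have hd : ∀ᵐ z ∂P, ∀ k : Fin n, z.2 k = 0 ∨ (0 ≤ z.2 k ∧ K (z.2 k) = k) := by
    refine Measure.quasiMeasurePreserving_snd.ae (p := fun d : Fin n → ℝ => ∀ k : Fin n, d k = 0 ∨ (0 ≤ d k ∧ K (d k) = k))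
      (ae_all_iff.2 fun k => ?_)
    exact Measure.tendsto_eval_ae_ae (μ := ν) (i := k) (hν2 k)
  have hsup : Measurable fun v : Fin n → ℝ => ⨆ i, v i :=
    Measurable.iSup fun i => measurable_pi_apply i
  let μ : instanceSet F n := ⟨P.map (decoyTuple K), by
    refine ⟨Measure.isProbabilityMeasure_map hX.aemeasurable, ?_, ?_⟩
    · rw [ae_all_iff]
      intro k
      rw [ae_map_iff hX.aemeasurable (measurableSet_le measurable_const (measurable_pi_apply k))]
      filter_upwards [h0, hd] with z hz hz'
      exact decoyTuple_nonneg hz hz' k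
    · rw [Measure.map_map hsup hX]
      have : (fun v : Fin n → ℝ => ⨆ i, v i) ∘ decoyTuple K =ᵐ[P] Prod.fst := by
        filter_upwards [h0, hd] with z hz hz'
        exact iSup_decoyTuple hK hKn hz hz'
      rw [Measure.map_congr this, hP, Measure.map_fst_prod, measure_univ, one_smul]⟩
  refine ciSup_le fun τ => ciInf_le_of_le (bddBelow_range_integral_payoff τ) μ ?_
  have hpm := τ.measurable_payoff
  rw [integral_eq_lintegral_of_nonneg_ae ?_ hpm.aestronglyMeasurable]
  swap
  · filter_upwards [μ.2.2.1] with v hv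
    exact τ.payoff_nonneg hv
  refine ENNReal.toReal_le_of_le_ofReal hV ?_
  change ∫⁻ v, _ ∂(P.map (decoyTuple K)) ≤ _
  rw [lintegral_map (by fun_prop) hX]
  have hσ (k : Fin n) := τ.measurable_stopProb k
  calc ∫⁻ z, ENNReal.ofReal (τ.payoff (decoyTuple K z)) ∂P
      ≤ ∫⁻ z, ∑ k, ENNReal.ofReal (decoyTuple K z k * τ.stopProb k (decoyTuple K z)) ∂P :=
        lintegral_mono fun z => Finset.le_sum_of_subadditive _ ENNReal.ofReal_zero.le
          (fun _ _ => ENNReal.ofReal_add_le) _ _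
    _ = ∑ k, ∫⁻ z, ENNReal.ofReal (decoyTuple K z k * τ.stopProb k (decoyTuple K z)) ∂P :=
        lintegral_finsetSum _ fun k _ => by fun_prop
    _ ≤ ∑ k, ENNReal.ofReal V * ∫⁻ d, ENNReal.ofReal (τ.stopProb k d) ∂(Measure.pi ν) :=
        Finset.sum_le_sum fun k _ => lintegral_decoyTuple_term_le hKm τ k V ν (hν3 k)
    _ = ENNReal.ofReal V * ∫⁻ d, ENNReal.ofReal (∑ k, τ.stopProb k d) ∂(Measure.pi ν) := by
        rw [← Finset.mul_sum, ← lintegral_finsetSum _ fun k _ => by fun_prop]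
        congr 2
        ext d
        rw [ENNReal.ofReal_sum_of_nonneg fun k _ => τ.stopProb_nonneg k d]
    _ ≤ ENNReal.ofReal V * ∫⁻ _, 1 ∂(Measure.pi ν) := by
        gcongr with d
        exact ENNReal.ofReal_le_one.2 (τ.sum_stopProb_le_one d)
    _ = ENNReal.ofReal V := by simp

/-! ### Classes cut out by a chain of prices -/

/-- Increasing prices from `0` to `b` in `m` steps, each from some `a` to at most
`V / F [a, ∞)`. -/
inductive PriceChain (F : Measure ℝ) (V : ℝ) : ℝ → ℕ → Prop
  | zero : PriceChain F V 0 0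
  | step {a b : ℝ} {m : ℕ} : PriceChain F V a m → a ≤ b → b * F.real (Set.Ici a) ≤ V →
      PriceChain F V b (m + 1)

lemma PriceChain.nonneg {F : Measure ℝ} {V a : ℝ} {m : ℕ} (h : PriceChain F V a m) : 0 ≤ a := by
  induction h with
  | zero => exact le_rfl
  | step _ hab _ ih => exact ih.trans hab

/-- The density increases in y, so the integral is at most b (S(a) - S(b)) / (V - b S(b)), where
S(q) is the mass of [q, ∞). This is at most 1 exactly when b S(a) ≤ V. -/
lemma lintegral_Ico_le_one {F : Measure ℝ} [IsProbabilityMeasure F] {a b V : ℝ} (ha : 0 ≤ a)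
    (hab : a ≤ b) (hb : revenue F b < V) (h : b * F.real (Set.Ici a) ≤ V) :
    ∫⁻ y in Set.Ico a b, ENNReal.ofReal (y / (V - y * F.real (Set.Ici b))) ∂F ≤ 1 := by
  have hb0 : 0 ≤ b := ha.trans hab
  set s := F.real (Set.Ici b) with hs
  have hs0 : 0 ≤ s := measureReal_nonneg
  have hpos : 0 < V - b * s := sub_pos.2 hb
  have hIco : F.real (Set.Ico a b) = F.real (Set.Ici a) - s := by
    rw [← Set.Ici_sdiff_Ici, measureReal_sdiff (Set.Ici_subset_Ici.2 hab) measurableSet_Ici]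
  calc ∫⁻ y in Set.Ico a b, ENNReal.ofReal (y / (V - y * s)) ∂F
      ≤ ∫⁻ _ in Set.Ico a b, ENNReal.ofReal (b / (V - b * s)) ∂F := by
        refine setLIntegral_mono measurable_const fun y hy => ENNReal.ofReal_le_ofReal ?_
        have hy1 : y ≤ b := hy.2.le
        have : y * s ≤ b * s := mul_le_mul_of_nonneg_right hy1 hs0
        exact div_le_div₀ hb0 hy1 hpos (by linarith)
    _ = ENNReal.ofReal (b / (V - b * s) * F.real (Set.Ico a b)) := by
        rw [setLIntegral_const, ENNReal.ofReal_mul (div_nonneg hb0 hpos.le), ofReal_measureReal]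
    _ ≤ 1 := by
        rw [ENNReal.ofReal_le_one, hIco, div_mul_eq_mul_div, div_le_one hpos]
        linarith

/-- Each step of the chain contributes one class [a, b). Class 0 collects the negative values, and
index m + 1 is left for everything above the last price. -/
lemma PriceChain.exists_classes {F : Measure ℝ} (hF : IsValueLaw F) {V : ℝ}
    (hV : ∀ q, 0 ≤ q → revenue F q < V) {a : ℝ} {m : ℕ} (h : PriceChain F V a m) :
    ∃ K : ℝ → ℕ, Monotone K ∧ (∀ y, K y < m + 1 ↔ y < a) ∧ (∀ y, K y ≤ m + 1) ∧
      ∀ k < m + 1, (∀ᵐ y ∂F, K y = k → y * F.real {z | k < K z} < V) ∧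
        ∫⁻ y in {y | K y = k}, ENNReal.ofReal (y / (V - y * F.real {z | k < K z})) ∂F ≤ 1 := by
  have := hF.isProbabilityMeasure
  induction h with
  | zero =>
    refine ⟨fun y => if y < 0 then 0 else 1, ?_, ?_, ?_, ?_⟩
    · intro y z hyz
      dsimp only
      split_ifs <;> first | omega | linarith
    · intro y
      dsimp only
      split_ifs with h <;> simp [h]
    · intro y
      dsimp only
      split_ifs <;> omega
    · intro k hk
      obtain rfl : k = 0 := by omega
      have hcl : ∀ᵐ y ∂F, ¬ (if y < 0 then 0 else 1) = 0 := by
        filter_upwards [hF.nonneg] with y hy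
        simp [hy.not_gt]
      refine ⟨?_, ?_⟩
      · filter_upwards [hcl] with y hy h
        exact absurd h hy
      · rw [setLIntegral_measure_zero _ _ (by rw [← compl_mem_ae_iff]; exact hcl)]
        exact zero_le_one
  | @step a b m hchain hab hstep ih =>
    obtain ⟨K, hK, hKa, hKm, hk⟩ := ih
    have hKle : ∀ y, a ≤ y → K y = m + 1 := fun y hy =>
      le_antisymm (hKm y) (not_lt.1 fun h => absurd ((hKa y).1 h) hy.not_gt)
    -- The old top class [a, ∞) is split at b; lower classes and the masses above them are
    -- unchanged.
    refine ⟨fun y => if y < b then K y else m + 2, ?_, ?_, ?_, ?_⟩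
    · intro y z hyz
      have := hK hyz
      have := hKm y
      dsimp only
      split_ifs <;> first | omega | linarith
    · intro y
      have := hKm y
      dsimp only
      split_ifs with h
      · simp only [h, iff_true]; omega
      · simp [h]
    · intro y
      have := hKm y
      dsimp only
      split_ifs <;> omega
    · intro k hk'
      have hk'' : k ≤ m + 1 := by omega
      rcases hk''.lt_or_eq with hlt | rfl
      · have e1 : ∀ y, (if y < b then K y else m + 2) = k ↔ K y = k := by
          intro y
          split_ifs with h
          · rfl
          · rw [hKle y (hab.trans (not_lt.1 h))]; omega
        have e2 : ∀ y, k < (if y < b then K y else m + 2) ↔ k < K y := by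
          intro y
          split_ifs with h
          · rfl
          · rw [hKle y (hab.trans (not_lt.1 h))]; omega
        simp only [e1, e2]
        exact hk k hlt
      · have e1 : {y | (if y < b then K y else m + 2) = m + 1} = Set.Ico a b := by
          ext y
          have h1 := hKa y
          have h2 := hKm y
          simp only [Set.mem_ofPred_eq, Set.mem_Ico]
          split_ifs with h
          · simp only [h, and_true, ← not_lt, ← h1]; omega
          · simp [h]
        have e2 : {y | m + 1 < (if y < b then K y else m + 2)} = Set.Ici b := by
          ext y
          have h2 := hKm y
          simp only [Set.mem_ofPred_eq, Set.mem_Ici]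
          split_ifs with h
          · simp only [h.not_ge, iff_false]; omega
          · simp [not_lt.1 h]
        have ha := hchain.nonneg
        have hb : revenue F b < V := hV b (ha.trans hab)
        simp only [e1, e2]
        refine ⟨Filter.Eventually.of_forall fun y hy => ?_, lintegral_Ico_le_one ha hab hb hstep⟩
        have hy' : y ∈ Set.Ico a b := e1 ▸ hy
        exact (mul_le_mul_of_nonneg_right hy'.2.le measureReal_nonneg).trans_lt hb

/-- The m chain classes are joined by the null class of negative values and the tail [T, ∞), hence m
+ 2. Nothing lies above the tail, so its decoy density is y / V and the mass condition becomes
`htail`. -/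
theorem PriceChain.robustValue_le {F : Measure ℝ} (hF : IsValueLaw F) {V : ℝ}
    (hV : ∀ q, 0 ≤ q → revenue F q < V) {T : ℝ} {m n : ℕ} (h : PriceChain F V T m)
    (htail : ∫⁻ y in Set.Ici T, ENNReal.ofReal y ∂F ≤ ENNReal.ofReal V) (hmn : m + 2 ≤ n) :
    robustValue F n ≤ V := by
  obtain ⟨K, hK, hKa, hKm, hk⟩ := h.exists_classes hF hV
  have hV0 : 0 < V := by simpa [revenue] using hV 0 le_rfl
  have hlast : ∀ k, m + 1 ≤ k → {z | k < K z} = ∅ := fun k hk => by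
    ext y
    have := hKm y
    simp only [Set.mem_ofPred_eq, Set.mem_empty_iff_false, iff_false]
    omega
  refine robustValue_le_of_classes hF hV0.le hK (fun y => (hKm y).trans_lt hmn) ?_ ?_
  · intro k _
    rcases lt_or_ge k (m + 1) with h1 | h1
    · exact (hk k h1).1
    · simp [hlast k h1, hV0]
  · intro k _
    rcases lt_or_ge k (m + 1) with h1 | h1
    · exact (hk k h1).2
    · have hsub : {y | K y = k} ⊆ Set.Ici T := fun y hy => by
        by_contra hlt
        have := (hKa y).2 (not_le.1 hlt)
        simp only [Set.mem_ofPred_eq] at hy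
        omega
      simp only [hlast k h1, measureReal_empty, mul_zero, sub_zero]
      refine (lintegral_mono_set hsub).trans ?_
      simp_rw [ENNReal.ofReal_div_of_pos hV0, div_eq_mul_inv]
      rw [lintegral_mul_const _ ENNReal.measurable_ofReal, ← div_eq_mul_inv]
      exact ENNReal.div_le_of_le_mul (by rwa [one_mul])

/-! ### Counting the price steps -/

lemma PriceChain.uniform {F : Measure ℝ} [IsProbabilityMeasure F] {V ε a b : ℝ} {m N : ℕ}
    (h : PriceChain F V a m) (hab : a ≤ b) (hε : ∀ q ∈ Set.Icc a b, revenue F q + ε ≤ V)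
    (hN : b - a ≤ N * ε) : PriceChain F V b (m + N) := by
  induction N generalizing a m with
  | zero =>
    have : a = b := by simp at hN; linarith
    simpa [← this] using h
  | succ N ih =>
    have hgap := hε a ⟨le_rfl, hab⟩
    have hS1 : F.real (Set.Ici a) ≤ 1 := measureReal_le_one
    have hS0 : 0 ≤ F.real (Set.Ici a) := measureReal_nonneg
    have hε0 : 0 ≤ ε := by
      by_contra! hneg
      push_cast at hN
      nlinarith [Nat.cast_nonneg (α := ℝ) N]
    have hmin : min b (a + ε) * F.real (Set.Ici a) ≤ V := by
      calc min b (a + ε) * F.real (Set.Ici a) ≤ (a + ε) * F.real (Set.Ici a) :=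
            mul_le_mul_of_nonneg_right (min_le_right _ _) hS0
        _ ≤ revenue F a + ε := by rw [revenue]; nlinarith
        _ ≤ V := hgap
    have hle : a ≤ min b (a + ε) := le_min hab (by linarith)
    have := ih (h.step hle hmin) (min_le_left _ _)
      (fun q hq => hε q ⟨hle.trans hq.1, hq.2⟩) (by
        push_cast at hN
        rcases min_cases b (a + ε) with ⟨e, _⟩ | ⟨e, _⟩ <;> rw [e]
        · have := mul_nonneg (Nat.cast_nonneg (α := ℝ) N) hε0
          linarith
        · linarith)
    rwa [add_assoc, add_comm 1 N] at this

/-- One step of length at most the slack of the revenue at its starting point. -/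
lemma PriceChain.step_of_sub_le {F : Measure ℝ} [IsProbabilityMeasure F] {V a b : ℝ} {m : ℕ}
    (h : PriceChain F V a m) (hab : a ≤ b) (hstep : b - a ≤ V - revenue F a) :
    PriceChain F V b (m + 1) := by
  refine h.step hab ?_
  have hS1 : F.real (Set.Ici a) ≤ 1 := measureReal_le_one
  rw [revenue] at hstep
  nlinarith

/-- At distance A/x from p the slack is at least c A²/x², which covers the step of length A/(x(x+1))
to distance A/(x+1). Reaching distance A/J thus takes fewer than J steps. -/
lemma PriceChain.toward {F : Measure ℝ} [IsProbabilityMeasure F] {V c p A : ℝ} {m j : ℕ}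
    (hc : 0 < c) (hA : 1 ≤ c * A) (hj : 1 ≤ j) (h : PriceChain F V (p - A / j) m)
    (hV : ∀ q ∈ Set.Icc (p - A / j) p, revenue F q + c * (q - p) ^ 2 ≤ V) (i : ℕ) :
    PriceChain F V (p - A / (j + i : ℕ)) (m + i) := by
  have hA0 : 0 < A := by by_contra! hneg; nlinarith
  induction i with
  | zero => simpa using h
  | succ i ih =>
    have hj0 : (0 : ℝ) < j := by exact_mod_cast hj
    set x : ℝ := ((j + i : ℕ) : ℝ) with hx
    have hxj : (j : ℝ) ≤ x := by rw [hx]; exact_mod_cast Nat.le_add_right j i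
    have hx0 : 0 < x := hj0.trans_le hxj
    have e : ((j + (i + 1) : ℕ) : ℝ) = x + 1 := by rw [hx]; push_cast; ring
    rw [e]
    have hgap := hV (p - A / x) ⟨by gcongr, by linarith [div_pos hA0 hx0]⟩
    refine ih.step_of_sub_le (by gcongr; linarith) ?_
    have h1 : p - A / (x + 1) - (p - A / x) = A / (x * (x + 1)) := by field_simp; ring
    have h2 : A / (x * (x + 1)) ≤ c * (p - A / x - p) ^ 2 := by
      rw [show c * (p - A / x - p) ^ 2 = c * A * A / (x * x) by field_simp; ring]
      gcongr
      · nlinarith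
      · linarith
    linarith

/-- The mirror image of `PriceChain.toward`. The step now starts at the smaller distance A/(x+1), so
the comparison loses a factor (x+1)/x ≤ 2; this is why c A must be at least 2. -/
lemma PriceChain.away {F : Measure ℝ} [IsProbabilityMeasure F] {V c p A : ℝ} {m j i : ℕ}
    (hc : 0 < c) (hA : 2 ≤ c * A) (hj : 1 ≤ j) (h : PriceChain F V (p + A / (j + i : ℕ)) m)
    (hV : ∀ q ∈ Set.Icc p (p + A / j), revenue F q + c * (q - p) ^ 2 ≤ V) :
    PriceChain F V (p + A / j) (m + i) := by
  have hA0 : 0 < A := by by_contra! hneg; nlinarith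
  induction i generalizing m with
  | zero => simpa using h
  | succ i ih =>
    have hj1 : (1 : ℝ) ≤ j := by exact_mod_cast hj
    have hj0 : (0 : ℝ) < j := by linarith
    have := ih (m := m + 1)
    rw [add_assoc, add_comm 1 i] at this
    refine this ?_
    set x : ℝ := ((j + i : ℕ) : ℝ) with hx
    have hxj : (j : ℝ) ≤ x := by rw [hx]; exact_mod_cast Nat.le_add_right j i
    have hx0 : 0 < x := hj0.trans_le hxj
    have e : ((j + (i + 1) : ℕ) : ℝ) = x + 1 := by rw [hx]; push_cast; ring
    rw [e] at h
    have hgap := hV (p + A / (x + 1)) ⟨by linarith [div_pos hA0 (show 0 < x + 1 by linarith)],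
      by gcongr; linarith⟩
    refine h.step_of_sub_le (by gcongr; linarith) ?_
    have h1 : p + A / x - (p + A / (x + 1)) = A / (x * (x + 1)) := by field_simp; ring
    have h2 : A / (x * (x + 1)) ≤ c * (p + A / (x + 1) - p) ^ 2 := by
      rw [show c * (p + A / (x + 1) - p) ^ 2 = c * A * A / ((x + 1) * (x + 1)) by field_simp; ring,
        div_le_div_iff₀ (by positivity) (by positivity)]
      have hx1 : x + 1 ≤ 2 * x := by linarith
      have : A * (x + 1) ≤ c * A * A * x := by
        calc A * (x + 1) ≤ A * (2 * x) := by gcongr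
          _ = 2 * A * x := by ring
          _ ≤ c * A * A * x := by gcongr
      nlinarith
    linarith

/-! ### The random threshold rule -/

/-- The cumulative distribution function of the uniform law on `[p, p + w]`. -/
noncomputable def uniformRamp (p w x : ℝ) : ℝ := max 0 (min 1 ((x - p) / w))

lemma uniformRamp_nonneg (p w x : ℝ) : 0 ≤ uniformRamp p w x := le_max_left _ _

lemma uniformRamp_le_one (p w x : ℝ) : uniformRamp p w x ≤ 1 :=
  max_le zero_le_one (min_le_left _ _)

lemma measurable_uniformRamp (p w : ℝ) : Measurable (uniformRamp p w) := by
  unfold uniformRamp; fun_prop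

lemma le_uniformRamp_iff {p w : ℝ} (hw : 0 < w) {y x : ℝ} (hy : 0 < y) (hy1 : y ≤ 1) :
    y ≤ uniformRamp p w x ↔ p + w * y ≤ x := by
  unfold uniformRamp
  rw [le_max_iff, le_min_iff, le_div_iff₀ hw]
  constructor
  · rintro (h | ⟨_, h⟩) <;> linarith
  · intro h
    exact Or.inr ⟨hy1, by linarith⟩

section RandomThreshold

variable (R : ℝ → ℝ) {n : ℕ}

/-- The largest value of `R`, at least `0`, among the first `k` entries of `v`. -/
noncomputable def runMax (v : Fin n → ℝ) : ℕ → ℝ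
  | 0 => 0
  | k + 1 => if h : k < n then max (runMax v k) (R (v ⟨k, h⟩)) else runMax v k

lemma runMax_succ (v : Fin n → ℝ) (i : Fin n) :
    runMax R v (i + 1) = max (runMax R v i) (R (v i)) := by simp [runMax]

lemma runMax_le_succ (v : Fin n → ℝ) (k : ℕ) : runMax R v k ≤ runMax R v (k + 1) := by
  rw [runMax]; split_ifs <;> simp

lemma runMax_mono (v : Fin n → ℝ) : Monotone (runMax R v) :=
  monotone_nat_of_le_succ (runMax_le_succ R v)

lemma runMax_nonneg (v : Fin n → ℝ) (k : ℕ) : 0 ≤ runMax R v k :=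
  runMax_mono R v (Nat.zero_le k)

lemma runMax_le_one (hR : ∀ x, R x ≤ 1) (v : Fin n → ℝ) (k : ℕ) : runMax R v k ≤ 1 := by
  induction k with
  | zero => simp [runMax]
  | succ k ih => rw [runMax]; split_ifs <;> simp [*]

lemma measurable_runMax (hR : Measurable R) (k : ℕ) :
    Measurable fun v : Fin n → ℝ => runMax R v k := by
  induction k with
  | zero => simp [runMax]
  | succ k ih =>
    by_cases h : k < n
    · simp only [runMax, h, dite_true]
      exact ih.max (hR.comp (measurable_pi_apply _))
    · simpa only [runMax, h, dite_false] using ih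

lemma runMax_congr (k : ℕ) {v w : Fin n → ℝ} (h : ∀ j : Fin n, (j : ℕ) < k → v j = w j) :
    runMax R v k = runMax R w k := by
  induction k with
  | zero => rfl
  | succ k ih =>
    rw [runMax, runMax, ih fun j hj => h j (hj.trans k.lt_succ_self)]
    split_ifs with hk
    · rw [h ⟨k, hk⟩ k.lt_succ_self]
    · rfl

lemma le_runMax (v : Fin n → ℝ) (i : Fin n) : R (v i) ≤ runMax R v n :=
  calc R (v i) ≤ runMax R v (i + 1) := by rw [runMax_succ]; exact le_max_right _ _
    _ ≤ runMax R v n := runMax_mono R v i.2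

/-- The rule that draws a threshold with cumulative distribution function `R` and takes the first
value that reaches it. -/
noncomputable def randomThresholdRule (n : ℕ) (hR : ∀ x, R x ≤ 1) (hRm : Measurable R) :
    StoppingRule n where
  r i v := (runMax R v (i + 1) - runMax R v i) / (1 - runMax R v i)
  nonneg i v := div_nonneg (sub_nonneg.2 (runMax_le_succ R v i))
    (sub_nonneg.2 (runMax_le_one R hR v i))
  le_one i v := div_le_one_of_le₀ (sub_le_sub_right (runMax_le_one R hR v _) _)
    (sub_nonneg.2 (runMax_le_one R hR v i))
  measurable i := ((measurable_runMax R hRm _).sub (measurable_runMax R hRm _)).div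
    (measurable_const.sub (measurable_runMax R hRm _))
  adapted i v w h := by
    rw [runMax_congr R (i + 1) fun j hj => h j (Nat.lt_succ_iff.1 hj),
      runMax_congr R i fun j hj => h j (le_of_lt (Fin.lt_def.2 hj))]

lemma prod_one_sub_runMax_increment (hR : ∀ x, R x ≤ 1) (v : Fin n → ℝ) (k : ℕ) :
    ∏ j ∈ Finset.range k, (1 - (runMax R v (j + 1) - runMax R v j) / (1 - runMax R v j))
      = 1 - runMax R v k := by
  induction k with
  | zero => simp [runMax]
  | succ k ih =>
    rw [Finset.prod_range_succ, ih]
    rcases (runMax_le_one R hR v k).lt_or_eq with h | h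
    · have : 1 - runMax R v k ≠ 0 := (sub_pos.2 h).ne'
      field_simp
      ring
    · have h1 : runMax R v (k + 1) = 1 :=
        le_antisymm (runMax_le_one R hR v _) (h ▸ runMax_le_succ R v k)
      simp [h, h1]

/-- The acceptance probability is a conditional one: the chance that the threshold lies in the new
increment, given that it exceeds the old running maximum. Multiplying by the survival probability
cancels the denominator. -/
lemma stopProb_randomThresholdRule (hR : ∀ x, R x ≤ 1) (hRm : Measurable R) (i : Fin n)
    (v : Fin n → ℝ) :
    (randomThresholdRule R n hR hRm).stopProb i v = runMax R v (i + 1) - runMax R v i := by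
  have h : ∏ j ∈ Finset.Iio i, (1 - (randomThresholdRule R n hR hRm).r j v)
      = 1 - runMax R v i := by
    rw [← prod_one_sub_runMax_increment R hR v i, ← Nat.Iio_eq_range, ← Fin.map_valEmbedding_Iio,
      Finset.prod_map]
    rfl
  rw [StoppingRule.stopProb, h]
  simp only [randomThresholdRule]
  rcases (runMax_le_one R hR v i).lt_or_eq with h | h
  · exact div_mul_cancel₀ _ (sub_pos.2 h).ne'
  -- If the running maximum is already 1, the quotient is 0/0 = 0 and the increment vanishes too.
  · have h1 : runMax R v (i + 1) = 1 :=
      le_antisymm (runMax_le_one R hR v _) (h ▸ runMax_le_succ R v i)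
    simp [h, h1]

end RandomThreshold

/-- The payoff dominates a right Riemann sum of p + w y over the jumps of the running maximum. It
exceeds the integral by w/2 times the sum of squared jumps, and n jumps with a given total have a
minimal sum of squares; this produces the 1/n. -/
lemma le_payoff_randomThresholdRule {p w : ℝ} (hp : 0 ≤ p) (hw : 0 < w) {n : ℕ} (hn : 1 ≤ n)
    (v : Fin n → ℝ) :
    p * uniformRamp p w (⨆ i, v i) +
        w * ((1 + 1 / n) / 2) * uniformRamp p w (⨆ i, v i) ^ 2 ≤
      (randomThresholdRule (uniformRamp p w) n (uniformRamp_le_one p w)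
        (measurable_uniformRamp p w)).payoff v := by
  set R := uniformRamp p w with hRdef
  have : Nonempty (Fin n) := ⟨⟨0, hn⟩⟩
  have hn0 : (0 : ℝ) < n := by exact_mod_cast hn
  set y : ℕ → ℝ := runMax R v with hy
  obtain ⟨i₀, hi₀⟩ := exists_eq_ciSup_of_finite (f := v)
  have hY : R (⨆ i, v i) ≤ y n := by rw [← hi₀]; exact le_runMax R v i₀
  have hR0 : 0 ≤ R (⨆ i, v i) := uniformRamp_nonneg p w _
  -- A nonzero jump means that `v i` sets a record, with `R (v i) = y (i + 1)`; inverting the ramp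
  -- gives the lower bound on `v i`.
  have hterm (i : Fin n) : (p + w * y (i + 1)) * (y (i + 1) - y i) ≤
      v i * (y (i + 1) - y i) := by
    rcases (runMax_le_succ R v i).lt_or_eq with h | h
    · refine mul_le_mul_of_nonneg_right ?_ (sub_nonneg.2 h.le)
      rw [runMax_succ] at h
      have hlt : y i < R (v i) := by
        rcases lt_max_iff.1 h with h | h
        · exact absurd h (lt_irrefl _)
        · exact h
      have e : y (i + 1) = R (v i) := by rw [hy, runMax_succ]; exact max_eq_right hlt.le
      rw [e]
      exact (le_uniformRamp_iff hw ((runMax_nonneg R v i).trans_lt hlt)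
        (uniformRamp_le_one p w _)).1 le_rfl
    · have : y (i + 1) - y i = 0 := sub_eq_zero.2 h.symm
      rw [this, mul_zero, mul_zero]
  have hsum : ∑ i ∈ Finset.range n, (p + w * y (i + 1)) * (y (i + 1) - y i) ≤
      (randomThresholdRule R n (uniformRamp_le_one p w) (measurable_uniformRamp p w)).payoff v := by
    rw [Finset.sum_range, StoppingRule.payoff]
    simp_rw [stopProb_randomThresholdRule]
    exact Finset.sum_le_sum fun i _ => hterm i
  have htel (m : ℕ) : ∑ i ∈ Finset.range m, (p + w * y (i + 1)) * (y (i + 1) - y i) =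
      p * y m + w / 2 * y m ^ 2 +
        w / 2 * ∑ i ∈ Finset.range m, (y (i + 1) - y i) ^ 2 := by
    induction m with
    | zero => simp [hy, runMax]
    | succ m ih => rw [Finset.sum_range_succ, ih, Finset.sum_range_succ]; ring
  have hcs : y n ^ 2 ≤ n * ∑ i ∈ Finset.range n, (y (i + 1) - y i) ^ 2 := by
    have h := sq_sum_le_card_mul_sum_sq (s := Finset.range n) (f := fun i => y (i + 1) - y i)
    rw [Finset.sum_range_sub, Finset.card_range] at h
    simpa [hy, runMax] using h
  have hcs' : y n ^ 2 / n ≤ ∑ i ∈ Finset.range n, (y (i + 1) - y i) ^ 2 := by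
    rw [div_le_iff₀ hn0, mul_comm]; exact hcs
  refine le_trans ?_ hsum
  rw [htel]
  have h2 : R (⨆ i, v i) ^ 2 ≤ y n ^ 2 := pow_le_pow_left₀ hR0 hY 2
  calc p * R (⨆ i, v i) + w * ((1 + 1 / n) / 2) * R (⨆ i, v i) ^ 2
      ≤ p * y n + w * ((1 + 1 / n) / 2) * y n ^ 2 := by gcongr
    _ = p * y n + w / 2 * y n ^ 2 + w / 2 * (y n ^ 2 / n) := by ring
    _ ≤ _ := by gcongr

/-! ### Local and global shape of the revenue function -/

/-- Second-order Taylor expansion from differentiability of h' at the single point p: the remainder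
has derivative o(x - p), and the mean value inequality integrates this. -/
lemma eventually_abs_sub_quadratic_le {h : ℝ → ℝ} {p D : ℝ}
    (hd : ∀ᶠ q in nhds p, DifferentiableAt ℝ h q) (h0 : deriv h p = 0)
    (h2 : HasDerivAt (deriv h) D p) {ε : ℝ} (hε : 0 < ε) :
    ∀ᶠ q in nhds p, |h q - h p - D / 2 * (q - p) ^ 2| ≤ ε * (q - p) ^ 2 := by
  have ho := (hasDerivAt_iff_isLittleO.1 h2).def hε
  obtain ⟨δ, hδ, hball⟩ := Metric.eventually_nhds_iff_ball.1 (hd.and ho)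
  filter_upwards [Metric.ball_mem_nhds p hδ] with q hq
  have hsub : ∀ x ∈ Metric.closedBall p |q - p|, x ∈ Metric.ball p δ := fun x hx =>
    Metric.mem_ball.2 (lt_of_le_of_lt (Metric.mem_closedBall.1 hx) hq)
  have hder : ∀ x ∈ Metric.closedBall p |q - p|,
      HasDerivAt (fun x => h x - D / 2 * (x - p) ^ 2) (deriv h x - D * (x - p)) x := by
    intro x hx
    have h1 := (hball x (hsub x hx)).1.hasDerivAt
    have h2 : HasDerivAt (fun x => D / 2 * (x - p) ^ 2) (D * (x - p)) x := by
      have := (((hasDerivAt_id x).sub_const p).pow 2).const_mul (D / 2)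
      exact this.congr_deriv (by simp only [id_eq]; push_cast; ring)
    exact h1.sub h2
  have key := (convex_closedBall p |q - p|).norm_image_sub_le_of_norm_deriv_le
    (f := fun x => h x - D / 2 * (x - p) ^ 2) (C := ε * |q - p|) (x := p) (y := q)
    (fun x hx => (hder x hx).differentiableAt) (fun x hx => ?_)
    (Metric.mem_closedBall_self (abs_nonneg _)) (by simp [Real.dist_eq])
  · simp only [Real.norm_eq_abs, sub_self] at key
    calc |h q - h p - D / 2 * (q - p) ^ 2|
        = |h q - D / 2 * (q - p) ^ 2 - (h p - D / 2 * 0 ^ 2)| := by congr 1; ring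
      _ ≤ ε * |q - p| * |q - p| := key
      _ = ε * (q - p) ^ 2 := by rw [mul_assoc, ← sq, sq_abs]
  · rw [(hder x hx).deriv]
    have h3 := (hball x (hsub x hx)).2
    rw [h0, sub_zero, smul_eq_mul, mul_comm (x - p)] at h3
    refine h3.trans ?_
    gcongr
    exact hx

lemma measureReal_Ici_eq {F : Measure ℝ} [IsProbabilityMeasure F] (q : ℝ) :
    F.real (Set.Ici q) = 1 - Function.leftLim (cdf F) q := by
  have h := (cdf F).measure_Ici (tendsto_cdf_atTop F) q
  rw [measure_cdf] at h
  rw [measureReal_def, h, ENNReal.toReal_ofReal]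
  exact sub_nonneg.2 (((monotone_cdf F).leftLim_le le_rfl).trans (cdf_le_one F q))

lemma measureReal_Ici_of_continuousAt {F : Measure ℝ} [IsProbabilityMeasure F] {q : ℝ}
    (h : ContinuousAt (cdf F) q) : F.real (Set.Ici q) = 1 - cdf F q := by
  rw [measureReal_Ici_eq, h.continuousWithinAt.leftLim_eq]

lemma antitone_measureReal_Ici (F : Measure ℝ) [IsProbabilityMeasure F] :
    Antitone fun q => F.real (Set.Ici q) := fun _ _ h => measureReal_mono (Set.Ici_subset_Ici.2 h)

lemma tendsto_measureReal_Ici {F : Measure ℝ} [IsProbabilityMeasure F] (q : ℝ) :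
    Filter.Tendsto (fun x => F.real (Set.Ici x)) (nhdsWithin q (Set.Iio q))
      (nhds (F.real (Set.Ici q))) := by
  have hlim := ((monotone_cdf F).leftLim.tendsto_leftLim q).const_sub 1
  rw [leftLim_leftLim ((monotone_cdf F).tendsto_leftLim q)] at hlim
  simpa only [measureReal_Ici_eq] using hlim

lemma exists_revenue_quadratic {F : Measure ℝ} [IsProbabilityMeasure F] {p : ℝ}
    (hp : IsUniqueMonopolyPrice F p) (hp0 : 0 < p) (hsmooth : ContDiffAt ℝ 3 (cdf F) p)
    (hsecond : 0 < 2 * deriv (cdf F) p + p * iteratedDeriv 2 (cdf F) p) :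
    ∃ c C η : ℝ, 0 < c ∧ 0 < C ∧ 0 < η ∧ η < p ∧ ∀ q, |q - p| ≤ η →
      revenue F q + c * (q - p) ^ 2 ≤ revenue F p ∧
      revenue F p ≤ revenue F q + C * (q - p) ^ 2 := by
  set G : ℝ → ℝ := ⇑(cdf F) with hG
  set h : ℝ → ℝ := fun q => q * (1 - G q) with hh
  have hdiff : ∀ᶠ q in nhds p, DifferentiableAt ℝ G q := by
    filter_upwards [hsmooth.eventually (by decide)] with q hq
    exact hq.differentiableAt (by decide)
  have hderiv : ∀ᶠ q in nhds p, HasDerivAt h (1 - G q - q * deriv G q) q := by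
    filter_upwards [hdiff] with q hq
    have := (hasDerivAt_id q).mul (hq.hasDerivAt.const_sub 1)
    exact this.congr_deriv (by simp only [id_eq]; ring)
  have hrev : ∀ᶠ q in nhds p, revenue F q = h q := by
    filter_upwards [hdiff] with q hq
    rw [revenue, measureReal_Ici_of_continuousAt hq.continuousAt]
  have hmax : IsLocalMax h p := by
    filter_upwards [hrev, eventually_gt_nhds hp0] with q hq hq0
    rw [← hq, ← hrev.self_of_nhds]
    rcases eq_or_ne q p with rfl | hne
    · exact le_rfl
    · exact (hp.2 q hq0.le hne).le
  have hG' : HasDerivAt (deriv G) (iteratedDeriv 2 G p) p := by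
    have h1 : DifferentiableAt ℝ (deriv G) p :=
      (ContDiffAt.derivWithin (m := 2) hsmooth (by norm_num)).differentiableAt (by decide)
    rw [iteratedDeriv_succ, iteratedDeriv_one]
    exact h1.hasDerivAt
  set D : ℝ := -(2 * deriv G p + p * iteratedDeriv 2 G p) with hD
  have hh' : HasDerivAt (deriv h) D p := by
    have h1 : HasDerivAt (fun q => 1 - G q - q * deriv G q) D p := by
      have := (hdiff.self_of_nhds.hasDerivAt.const_sub 1).sub ((hasDerivAt_id p).mul hG')
      exact this.congr_deriv (by simp only [id_eq, hD]; ring)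
    refine h1.congr_of_eventuallyEq ?_
    filter_upwards [hderiv] with q hq
    exact hq.deriv
  have hD0 : D < 0 := neg_neg_of_pos hsecond
  have hT := eventually_abs_sub_quadratic_le
    (hderiv.mono fun q hq => hq.differentiableAt) hmax.deriv_eq_zero hh' (ε := -D / 4) (by linarith)
  obtain ⟨δ, hδ, hball⟩ := Metric.eventually_nhds_iff.1 (hT.and hrev)
  -- The leading coefficient D/2 is known up to an error of |D|/4, which gives D/4 and 3D/4 as the
  -- two sides; η ≤ p/2 keeps the neighbourhood in the positive prices.
  refine ⟨-D / 4, -(3 * D / 4), min (δ / 2) (p / 2), by linarith, by linarith, by positivity,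
    (min_le_right _ _).trans_lt (by linarith), fun q hq => ?_⟩
  have hq' : dist q p < δ := by
    rw [Real.dist_eq]
    exact (hq.trans (min_le_left _ _)).trans_lt (by linarith)
  obtain ⟨h1, h2⟩ := hball hq'
  have h3 := abs_le.1 h1
  rw [h2, hrev.self_of_nhds]
  constructor <;> nlinarith [h3.1, h3.2]

/-- The mass of [q, ∞) is left-continuous and decreasing in q, so at an atom the revenue can only
jump down to the right. -/
lemma upperSemicontinuousOn_revenue (F : Measure ℝ) [IsProbabilityMeasure F] :
    UpperSemicontinuousOn (revenue F) (Set.Ici 0) := by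
  intro q hq y hy
  refine Filter.Eventually.filter_mono nhdsWithin_le_nhds ?_
  rw [← nhdsLT_sup_nhdsGE, Filter.eventually_sup]
  constructor
  · have h : Filter.Tendsto (revenue F) (nhdsWithin q (Set.Iio q)) (nhds (revenue F q)) :=
      (Filter.tendsto_id.mono_left nhdsWithin_le_nhds).mul (tendsto_measureReal_Ici q)
    exact h.eventually_lt_const hy
  · have h : ContinuousAt (fun x => x * F.real (Set.Ici q)) q := by fun_prop
    filter_upwards [(h.eventually_lt_const hy).filter_mono nhdsWithin_le_nhds,
      self_mem_nhdsWithin] with x hx hqx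
    exact (mul_le_mul_of_nonneg_left (antitone_measureReal_Ici F hqx)
      (le_trans (Set.mem_Ici.1 hq) hqx)).trans_lt hx

/-- An upper semicontinuous function attains its maximum on the compact set of prices in [0, T] away
from p, and uniqueness makes that maximum strictly smaller than the revenue at p. -/
lemma exists_revenue_gap {F : Measure ℝ} [IsProbabilityMeasure F] {p : ℝ}
    (hp : IsUniqueMonopolyPrice F p) {η : ℝ} (hη : 0 < η) (T : ℝ) :
    ∃ ε : ℝ, 0 < ε ∧ ∀ q, 0 ≤ q → q ≤ T → η ≤ |q - p| → revenue F q + ε ≤ revenue F p := by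
  set s : Set ℝ := Set.Icc 0 T ∩ {q | η ≤ |q - p|} with hs
  rcases s.eq_empty_or_nonempty with he | hne
  · refine ⟨1, one_pos, fun q h0 hT hq => ?_⟩
    have : q ∈ s := ⟨⟨h0, hT⟩, hq⟩
    simp [he] at this
  · have hclosed : IsClosed {q : ℝ | η ≤ |q - p|} :=
      isClosed_le continuous_const (by fun_prop)
    obtain ⟨a, ha, hmax⟩ := ((upperSemicontinuousOn_revenue F).mono
      fun q hq => hq.1.1).exists_isMaxOn hne (isCompact_Icc.inter_right hclosed)
    have hap : a ≠ p := by
      rintro rfl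
      have := ha.2
      simp only [Set.mem_ofPred_eq, sub_self, abs_zero] at this
      linarith
    refine ⟨revenue F p - revenue F a, sub_pos.2 (hp.2 a ha.1.1 hap), fun q h0 hT hq => ?_⟩
    have : revenue F q ≤ revenue F a := hmax ⟨⟨h0, hT⟩, hq⟩
    linarith

lemma exists_tail_le {F : Measure ℝ} (hF : IsValueLaw F) {V : ℝ} (hV : 0 < V) (a : ℝ) :
    ∃ T, a ≤ T ∧ ∫⁻ y in Set.Ici T, ENNReal.ofReal y ∂F ≤ ENNReal.ofReal V := by
  have := hF.isProbabilityMeasure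
  have hfin : ∫⁻ y, ENNReal.ofReal y ∂F ≠ ⊤ :=
    hF.integrable.lintegral_lt_top.ne
  have hzero : Filter.Tendsto (fun k : ℕ => F (Set.Ici (k : ℝ))) Filter.atTop (nhds 0) := by
    have h := tendsto_measure_iInter_atTop (μ := F) (s := fun k : ℕ => Set.Ici (k : ℝ))
      (fun k => measurableSet_Ici.nullMeasurableSet)
      (fun i j hij => Set.Ici_subset_Ici.2 (by exact_mod_cast hij)) ⟨0, measure_ne_top _ _⟩
    have he : ⋂ k : ℕ, Set.Ici (k : ℝ) = ∅ := by
      ext x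
      obtain ⟨k, hk⟩ := exists_nat_gt x
      simp only [Set.mem_iInter, Set.mem_Ici, Set.mem_empty_iff_false, iff_false, not_forall]
      exact ⟨k, not_le.2 hk⟩
    rwa [he, measure_empty] at h
  have h := tendsto_setLIntegral_zero hfin hzero
  have hev := (h.eventually_lt_const (ENNReal.ofReal_pos.2 hV)).and
    (Filter.eventually_ge_atTop ⌈a⌉₊)
  obtain ⟨k, hk, hka⟩ := hev.exists
  exact ⟨k, (Nat.le_ceil a).trans (by exact_mod_cast hka), hk.le⟩

/-! ### Bounds that make the supremum and the infima genuine -/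

lemma integral_iSup_of_mem_instanceSet {F : Measure ℝ} (hF : IsValueLaw F) {n : ℕ}
    {μ : Measure (Fin n → ℝ)} (hμ : μ ∈ instanceSet F n) :
    Integrable (fun v => ⨆ i, v i) μ ∧ ∫ v, ⨆ i, v i ∂μ = lawMean F := by
  have hsup : Measurable fun v : Fin n → ℝ => ⨆ i, v i :=
    Measurable.iSup fun i => measurable_pi_apply i
  have hF' := hF.integrable
  constructor
  · rw [← hμ.2.2] at hF'
    exact (integrable_map_measure measurable_id.aestronglyMeasurable hsup.aemeasurable).1 hF'
  · rw [lawMean, ← hμ.2.2]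
    exact (integral_map hsup.aemeasurable measurable_id.aestronglyMeasurable).symm

lemma integrable_payoff {F : Measure ℝ} (hF : IsValueLaw F) {n : ℕ}
    {μ : Measure (Fin n → ℝ)} (hμ : μ ∈ instanceSet F n) (τ : StoppingRule n) :
    Integrable τ.payoff μ := by
  refine (integral_iSup_of_mem_instanceSet hF hμ).1.mono'
    τ.measurable_payoff.aestronglyMeasurable ?_
  filter_upwards [hμ.2.1] with v hv
  rw [Real.norm_of_nonneg (τ.payoff_nonneg hv)]
  exact τ.payoff_le hv

lemma integral_payoff_le {F : Measure ℝ} (hF : IsValueLaw F) {n : ℕ}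
    {μ : Measure (Fin n → ℝ)} (hμ : μ ∈ instanceSet F n) (τ : StoppingRule n) :
    ∫ v, τ.payoff v ∂μ ≤ lawMean F := by
  rw [← (integral_iSup_of_mem_instanceSet hF hμ).2]
  refine integral_mono_ae (integrable_payoff hF hμ τ)
    (integral_iSup_of_mem_instanceSet hF hμ).1 ?_
  filter_upwards [hμ.2.1] with v hv
  exact τ.payoff_le hv

lemma instanceSet_nonempty {F : Measure ℝ} (hF : IsValueLaw F) {n : ℕ} (hn : 1 ≤ n) :
    Nonempty (instanceSet F n) := by
  have := hF.isProbabilityMeasure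
  have : Nonempty (Fin n) := ⟨⟨0, hn⟩⟩
  have hm : Measurable fun (x : ℝ) (_ : Fin n) => x := by fun_prop
  have hsup : Measurable fun v : Fin n → ℝ => ⨆ i, v i :=
    Measurable.iSup fun i => measurable_pi_apply i
  refine ⟨⟨F.map fun x _ => x, Measure.isProbabilityMeasure_map hm.aemeasurable, ?_, ?_⟩⟩
  · rw [ae_all_iff]
    intro k
    rw [ae_map_iff hm.aemeasurable (measurableSet_le measurable_const (measurable_pi_apply k))]
    exact hF.nonneg
  · rw [Measure.map_map hsup hm]
    convert Measure.map_id using 2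
    ext x
    simp

lemma iInf_integral_payoff_le_lawMean {F : Measure ℝ} (hF : IsValueLaw F) {n : ℕ} (hn : 1 ≤ n)
    (τ : StoppingRule n) :
    ⨅ μ : instanceSet F n, ∫ v, τ.payoff v ∂(μ : Measure (Fin n → ℝ)) ≤ lawMean F := by
  obtain ⟨μ⟩ := instanceSet_nonempty hF hn
  exact ciInf_le_of_le (bddBelow_range_integral_payoff τ) μ (integral_payoff_le hF μ.2 τ)

lemma robustValue_le_lawMean {F : Measure ℝ} (hF : IsValueLaw F) {n : ℕ} (hn : 1 ≤ n) :
    robustValue F n ≤ lawMean F :=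
  ciSup_le fun τ => iInf_integral_payoff_le_lawMean hF hn τ

lemma iInf_integral_payoff_le_robustValue {F : Measure ℝ} (hF : IsValueLaw F) {n : ℕ}
    (hn : 1 ≤ n) (τ : StoppingRule n) :
    ⨅ μ : instanceSet F n, ∫ v, τ.payoff v ∂(μ : Measure (Fin n → ℝ)) ≤ robustValue F n := by
  refine le_ciSup (f := fun τ : StoppingRule n =>
    ⨅ μ : instanceSet F n, ∫ v, τ.payoff v ∂(μ : Measure (Fin n → ℝ))) ⟨lawMean F, ?_⟩ τ
  rintro _ ⟨σ, rfl⟩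
  exact iInf_integral_payoff_le_lawMean hF hn σ

/-! ### Value guaranteed by the random threshold -/

/-- By Fubini the right-hand side is the average of the revenue at p + w y over y in (0, 1]: for
fixed x, integrate p + w y over those y whose threshold is at most x. -/
lemma le_integral_uniformRamp {F : Measure ℝ} [IsProbabilityMeasure F] {p w L : ℝ} (hp : 0 ≤ p)
    (hw : 0 < w) (hL : ∀ y ∈ Set.Ioc (0 : ℝ) 1, L ≤ revenue F (p + w * y)) :
    L ≤ ∫ x, (p * uniformRamp p w x + w / 2 * uniformRamp p w x ^ 2) ∂F := by
  set f : ℝ → ℝ → ℝ := fun y x => {z : ℝ × ℝ | p + w * z.1 ≤ z.2}.indicator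
    (fun z => p + w * z.1) (y, x) with hf
  have hS : MeasurableSet {z : ℝ × ℝ | p + w * z.1 ≤ z.2} :=
    measurableSet_le (by fun_prop) (by fun_prop)
  have hfm : Measurable (Function.uncurry f) :=
    Measurable.indicator (by fun_prop) hS
  have hae : ∀ᵐ z ∂((volume.restrict (Set.uIoc (0 : ℝ) 1)).prod F), z.1 ∈ Set.Ioc (0 : ℝ) 1 := by
    rw [Set.uIoc_of_le zero_le_one]
    exact Measure.quasiMeasurePreserving_fst.ae (ae_restrict_mem measurableSet_Ioc)
  have : IsFiniteMeasure (volume.restrict (Set.uIoc (0 : ℝ) 1)) := by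
    rw [Set.uIoc_of_le zero_le_one]
    infer_instance
  have hint : Integrable (Function.uncurry f) ((volume.restrict (Set.uIoc (0 : ℝ) 1)).prod F) := by
    refine Integrable.of_bound hfm.aestronglyMeasurable (p + w) ?_
    filter_upwards [hae] with z hz
    have h0 : 0 ≤ p + w * z.1 := by have := mul_nonneg hw.le hz.1.le; linarith
    have h1 : p + w * z.1 ≤ p + w := by have := mul_le_of_le_one_right hw.le hz.2; linarith
    simp only [Function.uncurry, hf, Set.indicator_apply]
    split_ifs
    · rwa [Real.norm_of_nonneg h0]
    · simp; linarith
  have hswap := intervalIntegral_integral_swap hint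
  have hinner (y : ℝ) : ∫ x, f y x ∂F = revenue F (p + w * y) := by
    have : (fun x => f y x) = (Set.Ici (p + w * y)).indicator fun _ => p + w * y := by
      ext x
      simp [hf, Set.indicator_apply]
    rw [this, integral_indicator_const _ measurableSet_Ici, smul_eq_mul, revenue, mul_comm]
  have houter (x : ℝ) : ∫ y in (0 : ℝ)..1, f y x =
      p * uniformRamp p w x + w / 2 * uniformRamp p w x ^ 2 := by
    set R := uniformRamp p w x with hR
    have hR0 : 0 ≤ R := uniformRamp_nonneg p w x
    have hR1 : R ≤ 1 := uniformRamp_le_one p w x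
    have h1 : ∫ y in (0 : ℝ)..1, f y x =
        ∫ y in Set.Ioc (0 : ℝ) 1, (Set.Ioc 0 R).indicator (fun y => p + w * y) y := by
      rw [intervalIntegral.integral_of_le zero_le_one]
      refine setIntegral_congr_fun measurableSet_Ioc fun y hy => ?_
      have := le_uniformRamp_iff (p := p) (x := x) hw hy.1 hy.2
      simp only [hf, Set.indicator_apply, Set.mem_ofPred_eq, Set.mem_Ioc, ← this, hy.1, true_and]
      rfl
    rw [h1, setIntegral_indicator measurableSet_Ioc,
      Set.inter_eq_right.2 (Set.Ioc_subset_Ioc_right hR1), ← intervalIntegral.integral_of_le hR0,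
      intervalIntegral.integral_add (by simp) (Continuous.intervalIntegrable (by fun_prop) _ _),
      intervalIntegral.integral_const, intervalIntegral.integral_const_mul, integral_id]
    simp
    ring
  simp only [hinner, houter] at hswap
  rw [← hswap, intervalIntegral.integral_of_le zero_le_one]
  have hri : IntegrableOn (fun y => revenue F (p + w * y)) (Set.Ioc (0 : ℝ) 1) := by
    have := hint.integral_prod_left
    rw [Set.uIoc_of_le zero_le_one] at this
    exact this.congr (Filter.Eventually.of_forall hinner)
  have hc : ∫ _ in Set.Ioc (0 : ℝ) 1, L = L := by simp
  rw [← hc]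
  exact setIntegral_mono_on (integrable_const L) hri measurableSet_Ioc hL

lemma measureReal_Ici_le_integral_uniformRamp_sq {F : Measure ℝ} [IsProbabilityMeasure F]
    {p w : ℝ} (hw : 0 < w) :
    F.real (Set.Ici (p + w)) ≤ ∫ x, uniformRamp p w x ^ 2 ∂F := by
  rw [← integral_indicator_one measurableSet_Ici]
  refine integral_mono_of_nonneg (Filter.Eventually.of_forall fun x =>
    Set.indicator_nonneg (fun _ _ => zero_le_one) x) ?_ (Filter.Eventually.of_forall fun x => ?_)
  · refine Integrable.of_bound
      ((measurable_uniformRamp p w).pow_const 2).aestronglyMeasurable 1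
      (Filter.Eventually.of_forall fun x => ?_)
    rw [Real.norm_of_nonneg (sq_nonneg _)]
    exact pow_le_one₀ (uniformRamp_nonneg p w x) (uniformRamp_le_one p w x)
  · by_cases hx : x ∈ Set.Ici (p + w)
    · have : 1 ≤ uniformRamp p w x :=
        (le_uniformRamp_iff hw one_pos le_rfl).2 (by simpa using hx)
      simp only [Set.indicator_of_mem hx, Pi.one_apply]
      exact one_le_pow₀ this
    · simpa [Set.indicator_of_notMem hx] using sq_nonneg (uniformRamp p w x)

/-- The payoff bound depends on the instance only through its maximum, so it integrates against F.
The part without 1/n averages the revenues; the rest is the overshoot bonus, bounded below on the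
event that the maximum is at least p + w. -/
theorem le_robustValue {F : Measure ℝ} (hF : IsValueLaw F) {n : ℕ} (hn : 1 ≤ n) {p w L : ℝ}
    (hp : 0 ≤ p) (hw : 0 < w) (hL : ∀ y ∈ Set.Ioc (0 : ℝ) 1, L ≤ revenue F (p + w * y)) :
    L + w / (2 * n) * F.real (Set.Ici (p + w)) ≤ robustValue F n := by
  have := hF.isProbabilityMeasure
  have := instanceSet_nonempty hF hn
  have hR := measurable_uniformRamp p w
  refine le_trans (le_ciInf fun μ => ?_) (iInf_integral_payoff_le_robustValue hF hn
    (randomThresholdRule (uniformRamp p w) n (uniformRamp_le_one p w) hR))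
  have hsup : Measurable fun v : Fin n → ℝ => ⨆ i, v i :=
    Measurable.iSup fun i => measurable_pi_apply i
  set g : ℝ → ℝ := fun x => p * uniformRamp p w x +
    w * ((1 + 1 / n) / 2) * uniformRamp p w x ^ 2 with hg
  have hgm : Measurable g := by fun_prop
  have hR1 (x : ℝ) : uniformRamp p w x ≤ 1 := uniformRamp_le_one p w x
  have hR0 (x : ℝ) : 0 ≤ uniformRamp p w x := uniformRamp_nonneg p w x
  have hi1 : Integrable (uniformRamp p w) F :=
    Integrable.of_bound hR.aestronglyMeasurable 1 (Filter.Eventually.of_forall fun x => by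
      rw [Real.norm_of_nonneg (hR0 x)]; exact hR1 x)
  have hi2 : Integrable (fun x => uniformRamp p w x ^ 2) F :=
    Integrable.of_bound (hR.pow_const 2).aestronglyMeasurable 1
      (Filter.Eventually.of_forall fun x => by
        rw [Real.norm_of_nonneg (sq_nonneg _)]; exact pow_le_one₀ (hR0 x) (hR1 x))
  have hig : Integrable g F := (hi1.const_mul _).add (hi2.const_mul _)
  have hi3 : Integrable (fun x => p * uniformRamp p w x + w / 2 * uniformRamp p w x ^ 2) F :=
    (hi1.const_mul _).add (hi2.const_mul _)
  have hmap : ∫ v, g (⨆ i, v i) ∂(μ : Measure (Fin n → ℝ)) = ∫ x, g x ∂F := by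
    rw [← integral_map hsup.aemeasurable hgm.aestronglyMeasurable, μ.2.2.2]
  have hige : Integrable (fun v => g (⨆ i, v i)) (μ : Measure (Fin n → ℝ)) := by
    rw [← μ.2.2.2] at hig
    exact (integrable_map_measure hgm.aestronglyMeasurable hsup.aemeasurable).1 hig
  calc L + w / (2 * n) * F.real (Set.Ici (p + w))
      ≤ ∫ x, (p * uniformRamp p w x + w / 2 * uniformRamp p w x ^ 2) ∂F +
          w / (2 * n) * ∫ x, uniformRamp p w x ^ 2 ∂F := by
        gcongr
        · exact le_integral_uniformRamp hp hw hL
        · exact measureReal_Ici_le_integral_uniformRamp_sq hw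
    _ = ∫ x, g x ∂F := by
        rw [← integral_const_mul, ← integral_add hi3 (hi2.const_mul _)]
        congr 1
        ext x
        simp only [hg]
        ring
    _ = ∫ v, g (⨆ i, v i) ∂(μ : Measure (Fin n → ℝ)) := hmap.symm
    _ ≤ _ := integral_mono hige (integrable_payoff hF μ.2 _)
        fun v => le_payoff_randomThresholdRule hp hw hn v

/-! ### Scaling -/

/-- The rule that applies `τ` to the tuple multiplied by `s`. -/
def StoppingRule.scale {n : ℕ} (τ : StoppingRule n) (s : ℝ) : StoppingRule n where
  r i v := τ.r i fun j => s * v j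
  nonneg i v := τ.nonneg i _
  le_one i v := τ.le_one i _
  measurable i := (τ.measurable i).comp (by fun_prop)
  adapted i v w h := τ.adapted i _ _ fun j hj => by rw [h j hj]

lemma StoppingRule.mul_payoff_scale {n : ℕ} (τ : StoppingRule n) (s : ℝ) (v : Fin n → ℝ) :
    s * (τ.scale s).payoff v = τ.payoff fun j => s * v j := by
  simp only [payoff, stopProb, scale, Finset.mul_sum, mul_assoc]

lemma IsValueLaw.map_mul {F : Measure ℝ} (hF : IsValueLaw F) {s : ℝ} (hs : 0 ≤ s) :
    IsValueLaw (F.map fun x => s * x) := by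
  have := hF.isProbabilityMeasure
  have hm : Measurable fun x : ℝ => s * x := by fun_prop
  refine ⟨Measure.isProbabilityMeasure_map hm.aemeasurable, ?_, ?_⟩
  · rw [ae_map_iff hm.aemeasurable measurableSet_Ici]
    filter_upwards [hF.nonneg] with x hx
    exact mul_nonneg hs hx
  · exact (integrable_map_measure measurable_id.aestronglyMeasurable hm.aemeasurable).2
      (hF.integrable.const_mul s)

lemma map_mul_mem_instanceSet {F : Measure ℝ} {n : ℕ} {μ : Measure (Fin n → ℝ)}
    (hμ : μ ∈ instanceSet F n) {s : ℝ} (hs : 0 ≤ s) :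
    μ.map (fun v j => s * v j) ∈ instanceSet (F.map fun x => s * x) n := by
  have := hμ.1
  have hm : Measurable fun (v : Fin n → ℝ) j => s * v j := by fun_prop
  have hsup : Measurable fun v : Fin n → ℝ => ⨆ i, v i :=
    Measurable.iSup fun i => measurable_pi_apply i
  refine ⟨Measure.isProbabilityMeasure_map hm.aemeasurable, ?_, ?_⟩
  · rw [ae_all_iff]
    intro k
    rw [ae_map_iff hm.aemeasurable (measurableSet_le measurable_const (measurable_pi_apply k))]
    filter_upwards [hμ.2.1] with v hv
    exact mul_nonneg hs (hv k)
  · rw [← hμ.2.2, Measure.map_map hsup hm, Measure.map_map (by fun_prop) hsup]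
    congr 1
    ext v
    exact (Real.mul_iSup_of_nonneg hs v).symm

lemma robustValue_map_mul_le {F : Measure ℝ} (hF : IsValueLaw F) {n : ℕ} (hn : 1 ≤ n) {s : ℝ}
    (hs : 0 < s) : robustValue (F.map fun x => s * x) n ≤ s * robustValue F n := by
  refine ciSup_le fun τ => ?_
  have := instanceSet_nonempty hF hn
  rw [← div_le_iff₀' hs]
  refine le_trans (le_ciInf fun μ => ?_) (iInf_integral_payoff_le_robustValue hF hn (τ.scale s))
  rw [div_le_iff₀' hs, ← integral_const_mul]
  refine ciInf_le_of_le (bddBelow_range_integral_payoff τ)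
    ⟨_, map_mul_mem_instanceSet μ.2 hs.le⟩ ?_
  have hm : Measurable fun (v : Fin n → ℝ) j => s * v j := by fun_prop
  rw [integral_map hm.aemeasurable τ.measurable_payoff.aestronglyMeasurable]
  simp_rw [StoppingRule.mul_payoff_scale]
  exact le_rfl

theorem robustValue_map_mul {F : Measure ℝ} (hF : IsValueLaw F) {n : ℕ} (hn : 1 ≤ n) {s : ℝ}
    (hs : 0 < s) : robustValue (F.map fun x => s * x) n = s * robustValue F n := by
  refine le_antisymm (robustValue_map_mul_le hF hn hs) ?_
  -- The reverse inequality is the same one applied to the scaled law with factor 1/s.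
  have h := robustValue_map_mul_le (hF.map_mul hs.le) hn (inv_pos.2 hs)
  rw [Measure.map_map (by fun_prop) (by fun_prop)] at h
  have he : (fun x : ℝ => s⁻¹ * x) ∘ (fun x => s * x) = id := by
    ext x
    simp [inv_mul_cancel_left₀ hs.ne']
  rw [he, Measure.map_id, inv_mul_eq_div, le_div_iff₀' hs] at h
  exact h

lemma revenue_map_mul (F : Measure ℝ) {s : ℝ} (hs : 0 < s) (q : ℝ) :
    revenue (F.map fun x => s * x) q = s * revenue F (q / s) := by
  rw [revenue, revenue, map_measureReal_apply (by fun_prop) measurableSet_Ici]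
  have : (fun x : ℝ => s * x) ⁻¹' Set.Ici q = Set.Ici (q / s) := by
    ext x
    simp [div_le_iff₀' hs]
  rw [this]
  field_simp

lemma IsUniqueMonopolyPrice.revenue_le {F : Measure ℝ} {p : ℝ} (hp : IsUniqueMonopolyPrice F p)
    {q : ℝ} (hq : 0 ≤ q) : revenue F q ≤ revenue F p := by
  rcases eq_or_ne q p with rfl | h
  · exact le_rfl
  · exact (hp.2 q hq h).le

lemma optRevenue_map_mul {F : Measure ℝ} {p : ℝ} (hp : IsUniqueMonopolyPrice F p) {s : ℝ}
    (hs : 0 < s) : optRevenue (F.map fun x => s * x) = s * revenue F p := by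
  have hle : ∀ q : Set.Ici (0 : ℝ), revenue (F.map fun x => s * x) q ≤ s * revenue F p := by
    rintro ⟨q, hq⟩
    rw [revenue_map_mul F hs]
    exact mul_le_mul_of_nonneg_left (hp.revenue_le (div_nonneg hq hs.le)) hs.le
  refine le_antisymm (ciSup_le hle) ?_
  have hb : BddAbove (Set.range fun q : Set.Ici (0 : ℝ) => revenue (F.map fun x => s * x) q) := by
    refine ⟨s * revenue F p, ?_⟩
    rintro _ ⟨q, rfl⟩
    exact hle q
  refine le_ciSup_of_le hb ⟨s * p, mul_nonneg hs.le hp.1⟩ ?_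
  rw [revenue_map_mul F hs, mul_div_cancel_left₀ p hs.ne']

lemma IsUniqueMonopolyPrice.pos {F : Measure ℝ} {p : ℝ} (hp : IsUniqueMonopolyPrice F p) :
    0 < p := by
  refine hp.1.lt_of_ne fun h => ?_
  have h1 := hp.2 1 zero_le_one (by rw [← h]; exact one_ne_zero)
  rw [← h] at h1
  simp only [revenue, one_mul, zero_mul] at h1
  exact absurd h1 (not_lt.2 measureReal_nonneg)

lemma IsUniqueMonopolyPrice.revenue_pos {F : Measure ℝ} {p : ℝ}
    (hp : IsUniqueMonopolyPrice F p) : 0 < revenue F p := by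
  simpa [revenue] using hp.2 0 le_rfl hp.pos.ne

/-! ### The two rates of order 1/n² -/

lemma exists_robustValue_ge {F : Measure ℝ} (hF : IsValueLaw F) {p C η : ℝ}
    (hp : IsUniqueMonopolyPrice F p) (hC : 0 < C) (hη : 0 < η)
    (hquad : ∀ q, |q - p| ≤ η → revenue F p ≤ revenue F q + C * (q - p) ^ 2) :
    ∃ c : ℝ, 0 < c ∧ ∀ n : ℕ, 1 ≤ n → revenue F p + c * (1 / (n : ℝ) ^ 2) ≤ robustValue F n := by
  have := hF.isProbabilityMeasure
  -- This choice keeps the revenue at p + δ positive, hence also the mass s above p + δ, which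
  -- bounds the bonus below uniformly in n.
  obtain ⟨δ, hδ, hδη, hδC⟩ : ∃ δ, 0 < δ ∧ δ ≤ η ∧ C * δ ^ 2 < revenue F p := by
    have h : Filter.Tendsto (fun δ : ℝ => C * δ ^ 2) (nhdsWithin 0 (Set.Ioi 0)) (nhds 0) := by
      have : ContinuousAt (fun δ : ℝ => C * δ ^ 2) 0 := by fun_prop
      simpa [ContinuousAt] using this.mono_left nhdsWithin_le_nhds
    have hev := (h.eventually_lt_const hp.revenue_pos).and (Ioc_mem_nhdsGT hη)
    obtain ⟨δ, h1, h2⟩ := hev.exists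
    exact ⟨δ, h2.1, h2.2, h1⟩
  set s := F.real (Set.Ici (p + δ)) with hs
  have hs0 : 0 < s := by
    have h := hquad (p + δ) (by rwa [add_sub_cancel_left, abs_of_pos hδ])
    rw [add_sub_cancel_left] at h
    have h1 : 0 < revenue F (p + δ) := by linarith
    exact pos_of_mul_pos_right h1 (by linarith [hp.1])
  -- With w = ε/n the bonus is at least ε s/(2n²), and the loss C w² is at most half of that.
  set ε := min δ (s / (4 * C)) with hε
  have hε0 : 0 < ε := lt_min hδ (by positivity)
  have hεC : C * ε ≤ s / 4 := by
    calc C * ε ≤ C * (s / (4 * C)) := by gcongr; exact min_le_right _ _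
      _ = s / 4 := by field_simp
  refine ⟨ε * s / 4, by positivity, fun n hn => ?_⟩
  have hn1 : (1 : ℝ) ≤ n := by exact_mod_cast hn
  have hn0 : (0 : ℝ) < n := by linarith
  set w := ε / n with hw
  have hw0 : 0 < w := by positivity
  have hwδ : w ≤ δ := (div_le_self hε0.le hn1).trans (min_le_left _ _)
  have h := le_robustValue hF hn hp.1 hw0 (L := revenue F p - C * w ^ 2) (fun y hy => by
    have hwy0 : 0 ≤ w * y := mul_nonneg hw0.le hy.1.le
    have hwy : w * y ≤ w := mul_le_of_le_one_right hw0.le hy.2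
    have h := hquad (p + w * y) (by rw [add_sub_cancel_left, abs_of_nonneg hwy0]; linarith)
    rw [add_sub_cancel_left] at h
    have : C * (w * y) ^ 2 ≤ C * w ^ 2 := by gcongr
    linarith)
  refine le_trans ?_ h
  have hmono : s ≤ F.real (Set.Ici (p + w)) := antitone_measureReal_Ici F (by linarith)
  have h1 : w / (2 * n) * s ≤ w / (2 * n) * F.real (Set.Ici (p + w)) := by gcongr
  have h2 : w / (2 * n) * s = ε * s / 2 * (1 / (n : ℝ) ^ 2) := by rw [hw]; field_simp
  have h3 : C * w ^ 2 ≤ ε * s / 4 * (1 / (n : ℝ) ^ 2) := by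
    calc C * w ^ 2 = (C * ε) * (ε * (1 / (n : ℝ) ^ 2)) := by rw [hw]; field_simp
      _ ≤ s / 4 * (ε * (1 / (n : ℝ) ^ 2)) := by gcongr
      _ = ε * s / 4 * (1 / (n : ℝ) ^ 2) := by ring
  linarith

/-- The chain has five stretches: constant slack up to p - A/j, harmonic approach to p - A/J, a
window around p where only the slack e is available, harmonic departure to p + A/j, and constant
slack up to T. -/
lemma exists_robustValue_le {F : Measure ℝ} (hF : IsValueLaw F) {p c η : ℝ}
    (hp : IsUniqueMonopolyPrice F p) (hc : 0 < c) (hη : 0 < η) (hηp : η < p)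
    (hquad : ∀ q, |q - p| ≤ η → revenue F q + c * (q - p) ^ 2 ≤ revenue F p) :
    ∃ C : ℝ, 0 < C ∧ ∀ n : ℕ, 1 ≤ n → robustValue F n ≤ revenue F p + C * (1 / (n : ℝ) ^ 2) := by
  have := hF.isProbabilityMeasure
  obtain ⟨T, hT, htail⟩ := exists_tail_le hF hp.revenue_pos (p + η)
  set A := 2 / c with hA
  have hA0 : 0 < A := by positivity
  have hcA : c * A = 2 := by rw [hA]; field_simp
  set j := ⌈A / η⌉₊ + 1 with hj
  have hj1 : 1 ≤ j := by omega
  have hj0 : (0 : ℝ) < j := by exact_mod_cast hj1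
  have hjη : A / j ≤ η := by
    rw [div_le_comm₀ hj0 hη]
    refine (Nat.le_ceil _).trans ?_
    rw [hj]
    exact_mod_cast Nat.le_succ _
  obtain ⟨ε, hε, hgap⟩ := exists_revenue_gap hp (div_pos hA0 hj0) T
  set N₁ := ⌈p / ε⌉₊ with hN₁
  set N₂ := ⌈T / ε⌉₊ with hN₂
  have hp0 := hp.pos
  have hN₁' : p ≤ N₁ * ε := (div_le_iff₀ hε).1 (Nat.le_ceil _)
  have hN₂' : T ≤ N₂ * ε := (div_le_iff₀ hε).1 (Nat.le_ceil _)
  -- For n ≥ n₀ and J = ⌊n/8⌋ this gives J ≥ j and leaves room for all classes: the three middle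
  -- stretches use at most 3J ≤ 3n/8 steps, the others with the two extra classes at most n/2.
  set n₀ := 8 * j + 2 * (N₁ + N₂ + 2) with hn₀
  have hmean : 0 ≤ lawMean F := integral_nonneg_of_ae hF.nonneg
  -- The first summand settles n < n₀ through the trivial bound by the mean. The second makes J
  -- steps of length e cross the window of width 2A/J; since n ≤ 16 J, the constant 2 · 16² = 512
  -- suffices.
  refine ⟨n₀ ^ 2 * lawMean F + 512 * A, by positivity, fun n hn => ?_⟩
  set C := n₀ ^ 2 * lawMean F + 512 * A with hC
  have hn0 : (0 : ℝ) < n := by exact_mod_cast hn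
  have hC0 : 0 < C := by positivity
  have hCA : 512 * A ≤ C := by rw [hC]; exact le_add_of_nonneg_left (by positivity)
  rcases lt_or_ge n n₀ with hlt | hge
  · have hle : (n : ℝ) ^ 2 ≤ (n₀ : ℝ) ^ 2 := by gcongr
    have : lawMean F ≤ C * (1 / (n : ℝ) ^ 2) := by
      rw [mul_one_div, le_div_iff₀ (by positivity)]
      have := mul_le_mul_of_nonneg_right hle hmean
      linarith
    linarith [robustValue_le_lawMean hF hn, hp.revenue_pos]
  · set J := n / 8 with hJ
    obtain ⟨i, hi⟩ : ∃ i, J = j + i := Nat.exists_eq_add_of_le (by omega)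
    have hJ0 : (0 : ℝ) < J := by
      have : 0 < J := by omega
      exact_mod_cast this
    have hnJ : (n : ℝ) ≤ 16 * J := by
      have : n ≤ 16 * J := by omega
      exact_mod_cast this
    have hAJ : A / J ≤ A / j := by
      gcongr
      omega
    have hAJ0 : 0 < A / J := by positivity
    set e := C * (1 / (n : ℝ) ^ 2) with he
    have he0 : 0 < e := by positivity
    have hmid : 2 * (A / J) ≤ J * e := by
      have h1 : (n : ℝ) ^ 2 ≤ (16 * J) ^ 2 := by gcongr
      rw [he, show 2 * (A / J) = 2 * A / J by ring,
        show J * (C * (1 / (n : ℝ) ^ 2)) = J * C / (n : ℝ) ^ 2 by ring,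
        div_le_div_iff₀ hJ0 (by positivity)]
      calc 2 * A * (n : ℝ) ^ 2 ≤ 2 * A * (16 * J) ^ 2 := by gcongr
        _ = 512 * A * J * J := by ring
        _ ≤ J * C * J := by
          rw [mul_comm (J : ℝ) C]
          gcongr
    have h1 : PriceChain F (revenue F p + e) (p - A / j) (0 + N₁) := by
      refine PriceChain.zero.uniform (ε := ε) (by linarith) (fun q hq => ?_) (by linarith)
      have := hgap q hq.1 (by linarith [hq.2]) (by
        rw [abs_sub_comm]; exact le_trans (by linarith [hq.2]) (le_abs_self _))
      linarith
    have h2 := h1.toward hc (by linarith) hj1 (fun q hq => by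
      have := hquad q (abs_le.2 ⟨by linarith [hq.1], by linarith [hq.2]⟩)
      linarith) i
    rw [← hi] at h2
    have h3 : PriceChain F (revenue F p + e) (p + A / J) (0 + N₁ + i + J) := by
      refine h2.uniform (ε := e) (by linarith) (fun q hq => ?_) (by linarith)
      linarith [hp.revenue_le (q := q) (by linarith [hq.1])]
    rw [hi] at h3
    have h4 := h3.away hc hcA.ge hj1 (fun q hq => by
      have := hquad q (abs_le.2 ⟨by linarith [hq.1], by linarith [hq.2]⟩)
      linarith)
    have hjpos : 0 < A / j := by positivity
    have h5 := h4.uniform (ε := ε) (b := T) (N := N₂) (by linarith) (fun q hq => by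
      have := hgap q (by linarith [hq.1]) hq.2
        (le_trans (by linarith [hq.1]) (le_abs_self _))
      linarith) (by linarith)
    refine h5.robustValue_le hF (fun q hq => ?_)
      (htail.trans (ENNReal.ofReal_le_ofReal (by linarith))) (by omega)
    linarith [hp.revenue_le hq]

theorem mainTheorem5 (Fbase : Measure ℝ) (hbase : IsValueLaw Fbase)
    (p : ℝ) (hp : IsUniqueMonopolyPrice Fbase p)
    (hsmooth : ContDiffAt ℝ 3 (cdf Fbase) p)
    (hsecond : 0 < 2 * deriv (cdf Fbase) p + p * iteratedDeriv 2 (cdf Fbase) p) :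
    ∃ c₁ c₂ : ℝ, 0 < c₁ ∧ 0 < c₂ ∧
      ∀ Fmax : ℕ → Measure ℝ,
        (∀ n, 1 ≤ n → IsValueLaw (Fmax n) ∧ 0 < lawMean (Fmax n) ∧
          (Fmax n).map (fun x => x / lawMean (Fmax n)) = Fbase) →
        ∀ n : ℕ, 1 ≤ n →
          optRevenue (Fmax n) + c₁ * (lawMean (Fmax n) / (n : ℝ) ^ 2) ≤ robustValue (Fmax n) n ∧
          robustValue (Fmax n) n ≤
            optRevenue (Fmax n) + c₂ * (lawMean (Fmax n) / (n : ℝ) ^ 2) := by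
  have := hbase.isProbabilityMeasure
  obtain ⟨c, C, η, hc, hC, hη, hηp, hquad⟩ := exists_revenue_quadratic hp hp.pos hsmooth hsecond
  obtain ⟨c₁, hc₁, h₁⟩ := exists_robustValue_ge hbase hp hC hη fun q hq => (hquad q hq).2
  obtain ⟨c₂, hc₂, h₂⟩ := exists_robustValue_le hbase hp hc hη hηp fun q hq => (hquad q hq).1
  refine ⟨c₁, c₂, hc₁, hc₂, fun Fmax hFmax n hn => ?_⟩
  obtain ⟨-, hs, hmap⟩ := hFmax n hn
  set s := lawMean (Fmax n) with hsdef
  -- Each law is the base law scaled by its own mean, so the constants obtained for the base law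
  -- serve every n.
  have hF : Fmax n = Fbase.map fun x => s * x := by
    rw [← hmap, Measure.map_map (by fun_prop) (by fun_prop)]
    have : (fun x : ℝ => s * x) ∘ (fun x => x / s) = id := by
      ext x
      simp [mul_div_cancel₀ x hs.ne']
    rw [this, Measure.map_id]
  rw [hF, optRevenue_map_mul hp hs, robustValue_map_mul hbase hn hs]
  have e (d : ℝ) : s * revenue Fbase p + d * (s / (n : ℝ) ^ 2) =
      s * (revenue Fbase p + d * (1 / (n : ℝ) ^ 2)) := by ring
  rw [e, e]
  exact ⟨mul_le_mul_of_nonneg_left (h₁ n hn) hs.le, mul_le_mul_of_nonneg_left (h₂ n hn) hs.le⟩
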